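/- Let $K$ be a field. A $K$-category is a category whose morphism sets are $K$-vector spaces with bilinear composition; it is Hom-finite if all $\mathcal C(X,Y)$ are finite dimensional, and Krull–Schmidt if it is additive and every object is a finite direct sum of indecomposable objects with local endomorphism rings. A $\mathcal C$-module is an additive covariant functor from $\mathcal C$ to abelian groups. For a full additive subcategory $\mathcal B$ of $\mathcal C$ let $I_{\mathcal B}$ be the two-sided ideal of morphisms that factor through an object of $\mathcal B$; $\mathcal B$ is additively closed if it is closed under isomorphisms and direct summands. The radical of $\mathcal C$ is $\mathrm{rad}_{\mathcal C}(X,Y)=\{h: 1_X-gh \text{ is invertible for all } g\in\mathcal C(Y,X)\}$. A two-sided ideal $I$ of $\mathcal C$ is heredity if $I^2=I$, $I\,\mathrm{rad}_{\mathcal C}\,I=0$, and $I(X,-)$ is a finitely generated projective $\mathcal C$-module for every $X$. Let $\{\mathcal B_j\}_{j\ge 0}$ be an ascending family of full additive subcategories of $\mathcal C$ with $\bigcup_j\mathcal B_j=\mathcal C$ (an exhaustive filtration; a finite one $\mathcal B_0\subseteq\dots\subseteq\mathcal B_n=\mathcal C$ is continued by $\mathcal B_j=\mathcal C$ for $j\ge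 n$). A Hom-finite Krull–Schmidt $K$-category $\mathcal C$ is quasi-hereditary with respect to $\{\mathcal B_j\}$ if $0=I_{\mathcal B_0}\subseteq I_{\mathcal B_1}\subseteq\cdots$ is an exhaustive chain of ideals such that $I_{\mathcal B_j}/I_{\mathcal B_{j-1}}$ is a heredity ideal of the quotient category $\mathcal C/I_{\mathcal B_{j-1}}$ for all $j\ge 1$. In that case, if the $\mathcal B_j$ are additively closed, the standard modules of level $j\geq 1$ are the modules $\mathcal C(E,-)/I_{\mathcal B_{j-1}}(E,-)$ with $E$ an indecomposable object of $\mathcal B_j$ that is not in $\mathcal B_{j-1}$. For a $\mathcal C$-module $F$ let $F^{[j]}$ be the trace of $\{\mathcal C(E,-)\}_{E\in\mathcal B_j}$ in $F$, that is, the sum of the images of all morphisms $\mathcal C(E,-)\to F$ with $E\in\mathcal B_j$; $F$ lies in $\mathcal F({}_{\mathcal C}\Delta)$ if, for every $j\ge 1$, $F^{[j]}/F^{[j-1]}$ is isomorphic to a finite direct sum of standard modules of level $j$. Let $\mathcal U$ and $\mathcal T$ be Hom-finite Krull–Schmidt $K$-categories that are quasi-hereditary with respect to filtrations $\{\mathcal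 U_j\}_{0\le j\le n}$ (finite, so $\mathcal U_n=\mathcal U$) and $\{\mathcal T_j\}_{j\ge 0}$ by additively closed full subcategories. Let $M:\mathcal U\otimes_K\mathcal T^{op}\to\mathrm{Mod}\,K$ be a $K$-linear functor, and suppose that the $\mathcal U$-module $M_T=M(-,T)$ lies in $\mathcal F({}_{\mathcal U}\Delta)$ for every $T\in\mathcal T$. Let $\Lambda=\left(\begin{smallmatrix}\mathcal T&0\\M&\mathcal U\end{smallmatrix}\right)$ be the triangular matrix category: its objects are the pairs $\left(\begin{smallmatrix}T&0\\M&U\end{smallmatrix}\right)$ with $T\in\mathcal T$ and $U\in\mathcal U$, its morphisms from $\left(\begin{smallmatrix}T&0\\M&U\end{smallmatrix}\right)$ to $\left(\begin{smallmatrix}T'&0\\M&U'\end{smallmatrix}\right)$ are the matrices $\left(\begin{smallmatrix}f&0\\m&g\end{smallmatrix}\right)$ with $f\in\mathcal T(T,T')$, $m\in M(U',T)$ and $g\in\mathcal U(U,U')$, and $$\left(\begin{smallmatrix}f_2&0\\m_2&g_2\end{smallmatrix}\right)\left(\begin{smallmatrix}f_1&0\\m_1&g_1\end{smallmatrix}\right)=\left(\begin{smallmatrix}f_2f_1&0\\M(1\otimes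 f_1^{op})(m_2)+M(g_2\otimes 1)(m_1)&g_2g_1\end{smallmatrix}\right).$$ Define full subcategories of $\Lambda$ by $$\Lambda_0=\left(\begin{smallmatrix}0&0\\M&0\end{smallmatrix}\right),\qquad \Lambda_j=\left\{\left(\begin{smallmatrix}0&0\\M&U\end{smallmatrix}\right):U\in\mathcal U_j\right\}\ (1\le j\le n),\qquad \Lambda_{n+j}=\left\{\left(\begin{smallmatrix}T&0\\M&U\end{smallmatrix}\right):T\in\mathcal T_j,\ U\in\mathcal U\right\}\ (j\ge 1),$$ where $0$ stands for any zero object. Then $\Lambda$ is a Hom-finite Krull–Schmidt $K$-category, $\{\Lambda_j\}_{j\ge 0}$ is an exhaustive filtration of $\Lambda$ by additively closed full additive subcategories, and $\Lambda$ is quasi-hereditary with respect to $\{\Lambda_j\}_{j\ge 0}$. -/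

import Mathlib

open CategoryTheory CategoryTheory.Limits Opposite
open scoped TensorProduct

universe w v u u₁ u₂

noncomputable section

namespace QHCat

/-! ### Hom-finite Krull–Schmidt categories -/

section Basic

instance hasBinaryBiproducts (C : Type u) [Category.{v} C] [Preadditive C]
    [HasFiniteBiproducts C] : HasBinaryBiproducts C :=
  hasBinaryBiproducts_of_finite_biproducts C

variable (C : Type u) [Category.{v} C]

/-- Every space of morphisms is a finite-dimensional `K`-vector space. -/
def IsHomFinite (K : Type w) [Field K] [Preadditive C] [Linear K C] : Prop :=
  ∀ X Y : C, FiniteDimensional K (X ⟶ Y)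

/-- Every object is a finite direct sum of indecomposable objects whose endomorphism rings are
local. -/
def IsKrullSchmidt [Preadditive C] [HasFiniteBiproducts C] : Prop :=
  ∀ X : C, ∃ (n : ℕ) (E : Fin n → C),
    (∀ i, Indecomposable (E i) ∧ IsLocalRing (End (E i))) ∧ Nonempty (X ≅ ⨁ E)

variable {C}

/-- The (full) subcategory of `C` on the objects satisfying `B` is an additive subcategory: it
contains a zero object and direct sums of any two of its objects. -/
structure IsAdditiveSubcat [Preadditive C] [HasFiniteBiproducts C] (B : ObjectProperty C) :
    Prop where
  exists_zero : ∃ Z, B Z ∧ IsZero Z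
  exists_biprod : ∀ X Y, B X → B Y → ∃ Z, B Z ∧ Nonempty (Z ≅ X ⊞ Y)

/-- A full additive subcategory is additively closed if it is closed under isomorphisms and
direct summands. -/
structure IsAdditivelyClosed [Preadditive C] [HasFiniteBiproducts C] (B : ObjectProperty C) :
    Prop extends IsAdditiveSubcat B where
  of_iso : ∀ X Y, (X ≅ Y) → B X → B Y
  of_summand : ∀ X Y, B (X ⊞ Y) → B X

/-- The radical of `C`: `h : X ⟶ Y` is radical if `1_X - g ∘ h` is invertible for all
`g : Y ⟶ X`. -/
def IsRadical [Preadditive C] {X Y : C} (h : X ⟶ Y) : Prop :=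
  ∀ g : Y ⟶ X, IsIso (𝟙 X - h ≫ g)

end Basic

/-! ### Modules over a category: subfunctors and quotients

A `C`-module is an additive functor from `C` to abelian groups. -/

section Modules

variable {C : Type u} [Category.{v} C]

instance hasFiniteBiproductsFunctor : HasFiniteBiproducts (C ⥤ AddCommGrpCat.{v}) :=
  HasFiniteBiproducts.of_hasFiniteProducts

/-- A subfunctor of a functor `F` from `C` to abelian groups. -/
structure Sub (F : C ⥤ AddCommGrpCat.{v}) where
  carrier : ∀ X : C, AddSubgroup (F.obj X)
  map_mem : ∀ {X Y : C} (f : X ⟶ Y) (x : F.obj X), x ∈ carrier X → F.map f x ∈ carrier Y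

namespace Sub

variable {F : C ⥤ AddCommGrpCat.{v}}

/-- The subfunctor, as a functor. -/
def toFunctor (G : Sub F) : C ⥤ AddCommGrpCat.{v} where
  obj X := AddCommGrpCat.of (G.carrier X)
  map {X Y} f := AddCommGrpCat.ofHom
    (((F.map f).hom.comp (G.carrier X).subtype).codRestrict (G.carrier Y)
      fun x => G.map_mem f x.1 x.2)
  map_id _ := AddCommGrpCat.hom_ext <| AddMonoidHom.ext fun x => Subtype.ext <|
    ConcreteCategory.congr_hom (F.map_id _) x.1
  map_comp f g := AddCommGrpCat.hom_ext <| AddMonoidHom.ext fun x => Subtype.ext <|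
    ConcreteCategory.congr_hom (F.map_comp f g) x.1

/-- The quotient functor `F / G`. -/
def quotient (G : Sub F) : C ⥤ AddCommGrpCat.{v} where
  obj X := AddCommGrpCat.of (F.obj X ⧸ G.carrier X)
  map {X Y} f := AddCommGrpCat.ofHom
    (QuotientAddGroup.map (G.carrier X) (G.carrier Y) (F.map f).hom
      fun x hx => G.map_mem f x hx)
  map_id X := AddCommGrpCat.hom_ext <| QuotientAddGroup.addMonoidHom_ext _ <|
    AddMonoidHom.ext fun x => congrArg (QuotientAddGroup.mk' (G.carrier X))
      (ConcreteCategory.congr_hom (F.map_id X) x)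
  map_comp {_ _ Z} f g := AddCommGrpCat.hom_ext <| QuotientAddGroup.addMonoidHom_ext _ <|
    AddMonoidHom.ext fun x => congrArg (QuotientAddGroup.mk' (G.carrier Z))
      (ConcreteCategory.congr_hom (F.map_comp f g) x)

/-- `G ∩ H`, as a subfunctor of `H`. -/
def restrict (G H : Sub F) : Sub H.toFunctor where
  carrier X := (G.carrier X).addSubgroupOf (H.carrier X)
  map_mem f x hx := G.map_mem f x.1 hx

instance toFunctor_additive [Preadditive C] [F.Additive] (G : Sub F) : G.toFunctor.Additive where
  map_add {_ _ f g} := AddCommGrpCat.hom_ext <| AddMonoidHom.ext fun x => Subtype.ext <|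
    ConcreteCategory.congr_hom (F.map_add (f := f) (g := g)) x.1

end Sub

/-- The trace of the modules `C(E,-)`, `E` in `B`, in `F`: the sum of the images of all morphisms
`C(E,-) ⟶ F` with `E` in `B`. -/
def trace [Preadditive C] (B : ObjectProperty C) (F : C ⥤ AddCommGrpCat.{v}) : Sub F where
  carrier X := ⨆ (E : C) (_ : B E) (η : preadditiveCoyoneda.obj (op E) ⟶ F), (η.app X).hom.range
  map_mem {X Y} f x hx := by
    suffices h : (⨆ (E : C) (_ : B E) (η : preadditiveCoyoneda.obj (op E) ⟶ F),
        (η.app X).hom.range) ≤ (⨆ (E : C) (_ : B E) (η : preadditiveCoyoneda.obj (op E) ⟶ F),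
        (η.app Y).hom.range).comap (F.map f).hom from h hx
    refine iSup_le fun E => iSup_le fun hE => iSup_le fun η => ?_
    rintro _ ⟨s, rfl⟩
    refine AddSubgroup.mem_iSup_of_mem E (AddSubgroup.mem_iSup_of_mem hE
      (AddSubgroup.mem_iSup_of_mem η ⟨(preadditiveCoyoneda.obj (op E)).map f s, ?_⟩))
    exact ConcreteCategory.congr_hom (η.naturality f) s

/-- `F` is finitely generated: a finite family of elements of `F` generates `F`, i.e. induces an
epimorphism onto `F` from a finite direct sum of representable modules `C(E i,-)`. -/
def IsFinGen (F : C ⥤ AddCommGrpCat.{v}) : Prop :=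
  ∃ (n : ℕ) (E : Fin n → C) (x : ∀ i, F.obj (E i)),
    ∀ (Y : C) (y : F.obj Y), ∃ s : ∀ i, E i ⟶ Y, y = ∑ i, F.map (s i) (x i)

end Modules

/-! ### Two-sided ideals, quotient categories, heredity chains -/

section Ideals

/-- A two-sided ideal of a preadditive category. In a `K`-linear category these are automatically
closed under scalars, see `TwoSidedIdeal.smul_mem`. -/
@[ext]
structure TwoSidedIdeal (C : Type u) [Category.{v} C] [Preadditive C] where
  hom : ∀ X Y : C, AddSubgroup (X ⟶ Y)
  comp_mem : ∀ {X Y Z : C} (f : X ⟶ Y) (g : Y ⟶ Z), f ∈ hom X Y → f ≫ g ∈ hom X Z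
  mem_comp : ∀ {X Y Z : C} (f : X ⟶ Y) (g : Y ⟶ Z), g ∈ hom Y Z → f ≫ g ∈ hom X Z

namespace TwoSidedIdeal

variable {C : Type u} [Category.{v} C] [Preadditive C]

theorem smul_mem {K : Type w} [Field K] [Linear K C] (I : TwoSidedIdeal C) {X Y : C} (a : K)
    {f : X ⟶ Y} (hf : f ∈ I.hom X Y) : a • f ∈ I.hom X Y := by
  have h := I.comp_mem f (a • 𝟙 Y) hf
  rwa [Linear.comp_smul, Category.comp_id] at h

/-- The congruence `f - g ∈ I`. -/
def rel (I : TwoSidedIdeal C) : HomRel C := fun X Y f g => f - g ∈ I.hom X Y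

instance rel_congruence (I : TwoSidedIdeal C) : Congruence I.rel where
  equivalence :=
    { refl := fun f => by simp [rel]
      symm := fun {f g} h => by
        have := neg_mem h
        rwa [neg_sub] at this
      trans := fun {f g h} h₁ h₂ => by
        have := add_mem h₁ h₂
        rwa [sub_add_sub_cancel] at this }
  comp_left f g g' h := by
    have := I.mem_comp f _ h
    rwa [Preadditive.comp_sub] at this
  comp_right g h := by
    have := I.comp_mem _ g h
    rwa [Preadditive.sub_comp] at this

/-- The quotient category `C / I`: the same objects, and `C(X,Y) / I(X,Y)` as morphisms. -/
abbrev Quot (I : TwoSidedIdeal C) : Type u := CategoryTheory.Quotient I.rel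

theorem rel_add (I : TwoSidedIdeal C) ⦃X Y : C⦄ (f₁ f₂ g₁ g₂ : X ⟶ Y) (hf : I.rel f₁ f₂)
    (hg : I.rel g₁ g₂) : I.rel (f₁ + g₁) (f₂ + g₂) := by
  have := add_mem hf hg
  rwa [← add_sub_add_comm] at this

instance quotPreadditive (I : TwoSidedIdeal C) : Preadditive I.Quot :=
  CategoryTheory.Quotient.preadditive I.rel I.rel_add

/-- The projection `C ⥤ C / I`. -/
abbrev proj (I : TwoSidedIdeal C) : C ⥤ I.Quot := CategoryTheory.Quotient.functor I.rel

instance proj_additive (I : TwoSidedIdeal C) : I.proj.Additive :=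
  CategoryTheory.Quotient.functor_additive I.rel I.rel_add

/-- The ideal `(J + I) / I` of `C / I`, i.e. `J / I` when `I ⊆ J`. -/
def modIdeal (J I : TwoSidedIdeal C) : TwoSidedIdeal I.Quot where
  hom X Y := (J.hom X.as Y.as).map (I.proj.mapAddHom (X := X.as) (Y := Y.as))
  comp_mem {X Y Z} f g := by
    rintro ⟨f, hf, rfl⟩
    obtain ⟨g, rfl⟩ := I.proj.map_surjective (X := Y.as) (Y := Z.as) g
    exact ⟨f ≫ g, J.comp_mem f g hf, I.proj.map_comp f g⟩
  mem_comp {X Y Z} f g := by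
    rintro ⟨g, hg, rfl⟩
    obtain ⟨f, rfl⟩ := I.proj.map_surjective (X := X.as) (Y := Y.as) f
    exact ⟨f ≫ g, J.mem_comp f g hg, I.proj.map_comp f g⟩

/-- The `C`-module `I(X,-)`, a submodule of `C(X,-)`. -/
def row (I : TwoSidedIdeal C) (X : C) : Sub (preadditiveCoyoneda.obj (op X)) where
  carrier Y := I.hom X Y
  map_mem f x hx := I.comp_mem x f hx

/-- `I` is a heredity ideal: `I ^ 2 = I`, `I · rad · I = 0`, and all `I(X,-)` are
finitely generated projective modules. -/
structure IsHeredity (I : TwoSidedIdeal C) : Prop where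
  idempotent : ∀ X Y : C, I.hom X Y = AddSubgroup.closure
    {h | ∃ (Z : C) (f : X ⟶ Z) (g : Z ⟶ Y), f ∈ I.hom X Z ∧ g ∈ I.hom Z Y ∧ f ≫ g = h}
  rad : ∀ {W X Y Z : C} (f : W ⟶ X) (h : X ⟶ Y) (g : Y ⟶ Z),
    f ∈ I.hom W X → IsRadical h → g ∈ I.hom Y Z → f ≫ h ≫ g = 0
  projective : ∀ X : C, Projective (AdditiveFunctor.of (I.row X).toFunctor)
  finGen : ∀ X : C, IsFinGen (I.row X).toFunctor

/-- `0 = I 0 ⊆ I 1 ⊆ ⋯` is a heredity chain of ideals of `C`. -/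
structure IsHeredityChain (I : ℕ → TwoSidedIdeal C) : Prop where
  zero : ∀ X Y : C, (I 0).hom X Y = ⊥
  mono : ∀ (j : ℕ) (X Y : C), (I j).hom X Y ≤ (I (j + 1)).hom X Y
  exhaustive : ∀ (X Y : C) (f : X ⟶ Y), ∃ j, f ∈ (I j).hom X Y
  heredity : ∀ j : ℕ, ((I (j + 1)).modIdeal (I j)).IsHeredity

end TwoSidedIdeal

variable {C : Type u} [Category.{v} C] [Preadditive C] [HasFiniteBiproducts C]

/-- The ideal `I_B` of the morphisms that factor through an object of the additive
subcategory `B`. -/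
def factorIdeal (B : ObjectProperty C) (hB : IsAdditiveSubcat B) : TwoSidedIdeal C where
  hom X Y :=
    { carrier := {f | ∃ (Z : C) (_ : B Z) (r : X ⟶ Z) (s : Z ⟶ Y), r ≫ s = f}
      zero_mem' := by
        obtain ⟨Z, hZ, -⟩ := hB.exists_zero
        exact ⟨Z, hZ, 0, 0, by simp⟩
      add_mem' := by
        rintro _ _ ⟨Z, hZ, r, s, rfl⟩ ⟨Z', hZ', r', s', rfl⟩
        obtain ⟨W, hW, ⟨e⟩⟩ := hB.exists_biprod Z Z' hZ hZ'
        exact ⟨W, hW, biprod.lift r r' ≫ e.inv, e.hom ≫ biprod.desc s s', by simp⟩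
      neg_mem' := by
        rintro _ ⟨Z, hZ, r, s, rfl⟩
        exact ⟨Z, hZ, -r, s, by simp⟩ }
  comp_mem := by
    rintro X Y Z _ g ⟨W, hW, r, s, rfl⟩
    exact ⟨W, hW, r, s ≫ g, by simp⟩
  mem_comp := by
    rintro X Y Z f _ ⟨W, hW, r, s, rfl⟩
    exact ⟨W, hW, f ≫ r, s, by simp⟩

/-- An exhaustive filtration of `C` by full additive subcategories. A finite filtration
`B 0 ⊆ ⋯ ⊆ B n = C` is continued by `B j = C` for `j ≥ n`. -/
structure IsExhaustiveFiltration (B : ℕ → ObjectProperty C) : Prop where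
  additive : ∀ j, IsAdditiveSubcat (B j)
  mono : ∀ (j : ℕ) (X : C), B j X → B (j + 1) X
  exhaustive : ∀ X : C, ∃ j, B j X

variable (K : Type w) [Field K] [Linear K C]

/-- The Hom-finite Krull–Schmidt `K`-category `C` is quasi-hereditary with respect to the
exhaustive filtration `B` by full additive subcategories. -/
structure IsQuasiHereditary (B : ℕ → ObjectProperty C) : Prop where
  homFinite : IsHomFinite C K
  krullSchmidt : IsKrullSchmidt C
  filtration : IsExhaustiveFiltration B
  heredityChain : TwoSidedIdeal.IsHeredityChain
    fun j => factorIdeal (B j) (filtration.additive j)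

/-- The standard module `C(E,-) / I_{B j}(E,-)`; it is the standard module of level `j + 1`
attached to `E` when `E` is indecomposable in `B (j + 1)` and not in `B j`. -/
def standard (B : ℕ → ObjectProperty C) (hB : ∀ j, IsAdditiveSubcat (B j)) (j : ℕ) (E : C) :
    C ⥤ AddCommGrpCat.{v} :=
  ((factorIdeal (B j) (hB j)).row E).quotient

/-- `F` lies in `F(Δ)`: for all `j ≥ 1`, the factor `F^[j] / F^[j-1]` of the trace filtration
of `F` is a finite direct sum of standard modules of level `j`. -/
def IsDeltaFiltered (B : ℕ → ObjectProperty C) (hB : ∀ j, IsAdditiveSubcat (B j))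
    (F : C ⥤ AddCommGrpCat.{v}) : Prop :=
  ∀ j : ℕ, ∃ (m : ℕ) (E : Fin m → C),
    (∀ i, Indecomposable (E i) ∧ B (j + 1) (E i) ∧ ¬ B j (E i)) ∧
    Nonempty (((trace (B j) F).restrict (trace (B (j + 1)) F)).quotient ≅
      ⨁ fun i => standard B hB j (E i))

end Ideals

/-! ### Tensor products of `K`-categories -/

section Tensor

/-- The opposite of a `K`-category is a `K`-category. -/
instance linearOp (K : Type w) [Field K] (C : Type u) [Category.{v} C] [Preadditive C] [Linear K C] : Linear K Cᵒᵖ where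
  homModule X Y :=
    { smul := fun a f => (a • f.unop).op
      one_smul := fun f => congrArg Quiver.Hom.op (one_smul K f.unop)
      mul_smul := fun a b f => congrArg Quiver.Hom.op (mul_smul a b f.unop)
      smul_zero := fun a => congrArg Quiver.Hom.op (smul_zero (A := Y.unop ⟶ X.unop) a)
      smul_add := fun a f g => congrArg Quiver.Hom.op (smul_add a f.unop g.unop)
      add_smul := fun a b f => congrArg Quiver.Hom.op (add_smul a b f.unop)
      zero_smul := fun f => congrArg Quiver.Hom.op (zero_smul K f.unop) }
  smul_comp _ _ _ a f g := congrArg Quiver.Hom.op (Linear.comp_smul _ _ _ g.unop a f.unop)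
  comp_smul _ _ _ f a g := congrArg Quiver.Hom.op (Linear.smul_comp _ _ _ a g.unop f.unop)

/-- The objects of the tensor product `C ⊗_K D` of two `K`-categories: pairs of objects. -/
@[ext]
structure TensorCat (K : Type w) (C : Type u₁) (D : Type u₂) where
  fst : C
  snd : D

namespace TensorCat

variable {K : Type w} [Field K] {C : Type u₁} [Category.{v} C] [Preadditive C] [Linear K C]
  {D : Type u₂} [Category.{v} D] [Preadditive D] [Linear K D]

/-- Morphisms `(p₁,q₁) ⟶ (p₂,q₂)` form `C(p₁,p₂) ⊗ D(q₁,q₂)`, and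
`(g₁ ⊗ g₂) ∘ (f₁ ⊗ f₂) = (g₁ ∘ f₁) ⊗ (g₂ ∘ f₂)`. -/
instance category : Category.{v} (TensorCat K C D) where
  Hom X Y := (X.fst ⟶ Y.fst) ⊗[K] (X.snd ⟶ Y.snd)
  id X := 𝟙 X.fst ⊗ₜ[K] 𝟙 X.snd
  comp {X Y Z} f g := TensorProduct.map₂ (Linear.comp (S := K) X.fst Y.fst Z.fst)
    (Linear.comp (S := K) X.snd Y.snd Z.snd) f g
  id_comp {X Y} f := by
    induction f using TensorProduct.induction_on with
    | zero => simp
    | tmul a b => simp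
    | add a b ha hb => rw [map_add, ha, hb]
  comp_id {X Y} f := by
    induction f using TensorProduct.induction_on with
    | zero => simp
    | tmul a b => simp
    | add a b ha hb => rw [map_add, LinearMap.add_apply, ha, hb]
  assoc {W X Y Z} f g h := by
    induction f using TensorProduct.induction_on with
    | zero => simp
    | add a b ha hb => simp only [map_add, LinearMap.add_apply, ha, hb]
    | tmul f₁ f₂ =>
      induction g using TensorProduct.induction_on with
      | zero => simp
      | add a b ha hb => simp only [map_add, LinearMap.add_apply, ha, hb]
      | tmul g₁ g₂ =>
        induction h using TensorProduct.induction_on with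
        | zero => simp
        | add a b ha hb => simp only [map_add, ha, hb]
        | tmul h₁ h₂ => simp

/-- The morphism `f ⊗ g` of `C ⊗_K D`. -/
def tmul {X Y : TensorCat K C D} (f : X.fst ⟶ Y.fst) (g : X.snd ⟶ Y.snd) : X ⟶ Y :=
  f ⊗ₜ[K] g

theorem tmul_id (X : TensorCat K C D) : tmul (𝟙 X.fst) (𝟙 X.snd) = 𝟙 X := rfl

theorem tmul_comp {X Y Z : TensorCat K C D} (f : X.fst ⟶ Y.fst) (g : X.snd ⟶ Y.snd)
    (f' : Y.fst ⟶ Z.fst) (g' : Y.snd ⟶ Z.snd) :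
    (tmul f g : X ⟶ Y) ≫ tmul f' g' = tmul (f ≫ f') (g ≫ g') := rfl

instance preadditive : Preadditive (TensorCat K C D) where
  homGroup X Y := inferInstanceAs (AddCommGroup ((X.fst ⟶ Y.fst) ⊗[K] (X.snd ⟶ Y.snd)))
  add_comp X Y Z f f' g := LinearMap.map_add₂ (TensorProduct.map₂
    (Linear.comp (S := K) X.fst Y.fst Z.fst) (Linear.comp (S := K) X.snd Y.snd Z.snd)) f f' g
  comp_add X Y Z f g g' := LinearMap.map_add (TensorProduct.map₂
    (Linear.comp (S := K) X.fst Y.fst Z.fst) (Linear.comp (S := K) X.snd Y.snd Z.snd) f) g g'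

instance linear : Linear K (TensorCat K C D) where
  homModule X Y := inferInstanceAs (Module K ((X.fst ⟶ Y.fst) ⊗[K] (X.snd ⟶ Y.snd)))
  smul_comp X Y Z a f g := LinearMap.map_smul₂ (TensorProduct.map₂
    (Linear.comp (S := K) X.fst Y.fst Z.fst) (Linear.comp (S := K) X.snd Y.snd Z.snd)) a f g
  comp_smul X Y Z f a g := LinearMap.map_smul (TensorProduct.map₂
    (Linear.comp (S := K) X.fst Y.fst Z.fst) (Linear.comp (S := K) X.snd Y.snd Z.snd) f) a g

theorem tmul_add_left {X Y : TensorCat K C D} (f f' : X.fst ⟶ Y.fst) (g : X.snd ⟶ Y.snd) :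
    (tmul (f + f') g : X ⟶ Y) = tmul f g + tmul f' g := TensorProduct.add_tmul f f' g

theorem tmul_add_right {X Y : TensorCat K C D} (f : X.fst ⟶ Y.fst) (g g' : X.snd ⟶ Y.snd) :
    (tmul f (g + g') : X ⟶ Y) = tmul f g + tmul f g' := TensorProduct.tmul_add f g g'

theorem tmul_smul_left {X Y : TensorCat K C D} (a : K) (f : X.fst ⟶ Y.fst)
    (g : X.snd ⟶ Y.snd) : (tmul (a • f) g : X ⟶ Y) = a • tmul f g :=
  TensorProduct.smul_tmul' a f g

theorem tmul_smul_right {X Y : TensorCat K C D} (a : K) (f : X.fst ⟶ Y.fst)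
    (g : X.snd ⟶ Y.snd) : (tmul f (a • g) : X ⟶ Y) = a • tmul f g :=
  TensorProduct.tmul_smul a f g

/-- The functor `C ⥤ C ⊗_K D`, `f ↦ f ⊗ 1_Y`. -/
def inl (K : Type w) [Field K] (C : Type u₁) [Category.{v} C] [Preadditive C] [Linear K C]
    {D : Type u₂} [Category.{v} D] [Preadditive D] [Linear K D] (Y : D) :
    C ⥤ TensorCat K C D where
  obj X := ⟨X, Y⟩
  map f := tmul f (𝟙 Y)
  map_id _ := rfl
  map_comp f g := by rw [tmul_comp, Category.id_comp]

end TensorCat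

end Tensor

/-! ### Triangular matrix categories -/

section Triangular

variable {K : Type w} [Field K]
  {𝒯 : Type u₁} [Category.{v} 𝒯] [Preadditive 𝒯] [Linear K 𝒯]
  {𝒰 : Type u₂} [Category.{v} 𝒰] [Preadditive 𝒰] [Linear K 𝒰]

/-- The objects `[[t, 0], [M, u]]` of the triangular matrix category `[[𝒯, 0], [M, 𝒰]]`. -/
@[ext]
structure TriCat (M : TensorCat K 𝒰 𝒯ᵒᵖ ⥤ ModuleCat.{v} K) where
  t : 𝒯
  u : 𝒰

namespace TriCat

variable (M : TensorCat K 𝒰 𝒯ᵒᵖ ⥤ ModuleCat.{v} K)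

/-- The `𝒰`-module `M_T = M(-,T)`. -/
def column (T : 𝒯) : 𝒰 ⥤ AddCommGrpCat.{v} :=
  TensorCat.inl K 𝒰 (op T) ⋙ M ⋙ forget₂ (ModuleCat.{v} K) AddCommGrpCat.{v}

variable {M}

/-- `m • f = M(1 ⊗ f^op)(m)` for `m ∈ M(U, T')` and `f : T ⟶ T'`. -/
def actT {T T' : 𝒯} {U : 𝒰} (f : T ⟶ T') :
    M.obj ⟨U, op T'⟩ →ₗ[K] M.obj ⟨U, op T⟩ :=
  (M.map (TensorCat.tmul (X := ⟨U, op T'⟩) (Y := ⟨U, op T⟩) (𝟙 U) f.op)).hom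

/-- `g • m = M(g ⊗ 1)(m)` for `m ∈ M(U, T)` and `g : U ⟶ U'`. -/
def actU {T : 𝒯} {U U' : 𝒰} (g : U ⟶ U') :
    M.obj ⟨U, op T⟩ →ₗ[K] M.obj ⟨U', op T⟩ :=
  (M.map (TensorCat.tmul (X := ⟨U, op T⟩) (Y := ⟨U', op T⟩) g (𝟙 (op T)))).hom

theorem actT_id {T : 𝒯} {U : 𝒰} (m : M.obj ⟨U, op T⟩) : actT (𝟙 T) m = m :=
  ConcreteCategory.congr_hom (M.map_id ⟨U, op T⟩) m

theorem actU_id {T : 𝒯} {U : 𝒰} (m : M.obj ⟨U, op T⟩) : actU (𝟙 U) m = m :=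
  ConcreteCategory.congr_hom (M.map_id ⟨U, op T⟩) m

theorem actT_comp {T T' T'' : 𝒯} {U : 𝒰} (f : T ⟶ T') (f' : T' ⟶ T'')
    (m : M.obj ⟨U, op T''⟩) : actT (f ≫ f') m = actT f (actT f' m) := by
  rw [actT, op_comp, ← Category.comp_id (𝟙 U)]
  exact ConcreteCategory.congr_hom (M.map_comp
    (TensorCat.tmul (X := ⟨U, op T''⟩) (Y := ⟨U, op T'⟩) (𝟙 U) f'.op)
    (TensorCat.tmul (X := ⟨U, op T'⟩) (Y := ⟨U, op T⟩) (𝟙 U) f.op)) m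

theorem actU_comp {T : 𝒯} {U U' U'' : 𝒰} (g : U ⟶ U') (g' : U' ⟶ U'')
    (m : M.obj ⟨U, op T⟩) : actU (g ≫ g') m = actU g' (actU g m) := by
  rw [actU, ← Category.comp_id (𝟙 (op T))]
  exact ConcreteCategory.congr_hom (M.map_comp
    (TensorCat.tmul (X := ⟨U, op T⟩) (Y := ⟨U', op T⟩) g (𝟙 (op T)))
    (TensorCat.tmul (X := ⟨U', op T⟩) (Y := ⟨U'', op T⟩) g' (𝟙 (op T)))) m

theorem actT_actU {T T' : 𝒯} {U U' : 𝒰} (f : T ⟶ T') (g : U ⟶ U') (m : M.obj ⟨U, op T'⟩) :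
    actT f (actU g m) = actU g (actT f m) := by
  have h₁ := ConcreteCategory.congr_hom (M.map_comp
    (TensorCat.tmul (X := ⟨U, op T'⟩) (Y := ⟨U', op T'⟩) g (𝟙 (op T')))
    (TensorCat.tmul (X := ⟨U', op T'⟩) (Y := ⟨U', op T⟩) (𝟙 U') f.op)) m
  have h₂ := ConcreteCategory.congr_hom (M.map_comp
    (TensorCat.tmul (X := ⟨U, op T'⟩) (Y := ⟨U, op T⟩) (𝟙 U) f.op)
    (TensorCat.tmul (X := ⟨U, op T⟩) (Y := ⟨U', op T⟩) g (𝟙 (op T)))) m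
  rw [TensorCat.tmul_comp, Category.comp_id, Category.id_comp] at h₁ h₂
  exact h₁.symm.trans h₂

/-- A morphism from `[[t, 0], [M, u]]` to `[[t', 0], [M, u']]` is a triple `(f, m, g)`, i.e. a
matrix `[[f, 0], [m, g]]`, with `f : t ⟶ t'`, `m ∈ M(u', t)` and `g : u ⟶ u'`; morphisms are
composed as matrices:
`[[f₂, 0], [m₂, g₂]] ∘ [[f₁, 0], [m₁, g₁]] = [[f₂ ∘ f₁, 0], [m₂ • f₁ + g₂ • m₁, g₂ ∘ g₁]]`. -/
instance category : Category.{v} (TriCat M) where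
  Hom X Y := (X.t ⟶ Y.t) × M.obj ⟨Y.u, op X.t⟩ × (X.u ⟶ Y.u)
  id X := (𝟙 X.t, 0, 𝟙 X.u)
  comp p q := (p.1 ≫ q.1, actT p.1 q.2.1 + actU q.2.2 p.2.1, p.2.2 ≫ q.2.2)
  id_comp p := by simp [actT_id]
  comp_id p := by simp [actU_id]
  assoc p q r := by
    simp [actT_comp, actU_comp, actT_actU, add_assoc]

/-- The matrix `[[f, 0], [m, g]]`. -/
def mkHom {X Y : TriCat M} (f : X.t ⟶ Y.t) (m : M.obj ⟨Y.u, op X.t⟩) (g : X.u ⟶ Y.u) : X ⟶ Y :=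
  (f, m, g)

theorem mkHom_comp {X Y Z : TriCat M} (f₁ : X.t ⟶ Y.t) (m₁ : M.obj ⟨Y.u, op X.t⟩)
    (g₁ : X.u ⟶ Y.u) (f₂ : Y.t ⟶ Z.t) (m₂ : M.obj ⟨Z.u, op Y.t⟩) (g₂ : Y.u ⟶ Z.u) :
    (mkHom f₁ m₁ g₁ : X ⟶ Y) ≫ mkHom f₂ m₂ g₂ =
      mkHom (f₁ ≫ f₂) (actT f₁ m₂ + actU g₂ m₁) (g₁ ≫ g₂) := rfl

theorem id_eq (X : TriCat M) : 𝟙 X = mkHom (𝟙 X.t) 0 (𝟙 X.u) := rfl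

theorem actT_add [M.Additive] {T T' : 𝒯} {U : 𝒰} (f f' : T ⟶ T') (m : M.obj ⟨U, op T'⟩) :
    actT (f + f') m = actT f m + actT f' m := by
  rw [actT, op_add, TensorCat.tmul_add_right, M.map_add]
  rfl

theorem actU_add [M.Additive] {T : 𝒯} {U U' : 𝒰} (g g' : U ⟶ U') (m : M.obj ⟨U, op T⟩) :
    actU (g + g') m = actU g m + actU g' m := by
  rw [actU, TensorCat.tmul_add_left, M.map_add]
  rfl

theorem actT_smul [M.Linear K] {T T' : 𝒯} {U : 𝒰} (a : K) (f : T ⟶ T')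
    (m : M.obj ⟨U, op T'⟩) : actT (a • f) m = a • actT f m := by
  have h : (a • f).op = a • f.op := rfl
  rw [actT, h, TensorCat.tmul_smul_right, M.map_smul]
  rfl

theorem actU_smul [M.Linear K] {T : 𝒯} {U U' : 𝒰} (a : K) (g : U ⟶ U')
    (m : M.obj ⟨U, op T⟩) : actU (a • g) m = a • actU g m := by
  rw [actU, TensorCat.tmul_smul_left, M.map_smul]
  rfl

instance preadditive [M.Additive] : Preadditive (TriCat M) where
  homGroup X Y := inferInstanceAs
    (AddCommGroup ((X.t ⟶ Y.t) × M.obj ⟨Y.u, op X.t⟩ × (X.u ⟶ Y.u)))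
  add_comp X Y Z p p' q := by
    refine Prod.ext (Preadditive.add_comp _ _ _ _ _ _) (Prod.ext ?_
      (Preadditive.add_comp _ _ _ _ _ _))
    change actT (p.1 + p'.1) q.2.1 + actU q.2.2 (p.2.1 + p'.2.1) =
      (actT p.1 q.2.1 + actU q.2.2 p.2.1) + (actT p'.1 q.2.1 + actU q.2.2 p'.2.1)
    rw [actT_add, map_add]
    abel
  comp_add X Y Z p q q' := by
    refine Prod.ext (Preadditive.comp_add _ _ _ _ _ _) (Prod.ext ?_
      (Preadditive.comp_add _ _ _ _ _ _))
    change actT p.1 (q.2.1 + q'.2.1) + actU (q.2.2 + q'.2.2) p.2.1 =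
      (actT p.1 q.2.1 + actU q.2.2 p.2.1) + (actT p.1 q'.2.1 + actU q'.2.2 p.2.1)
    rw [actU_add, map_add]
    abel

instance linear [M.Additive] [M.Linear K] : Linear K (TriCat M) where
  homModule X Y := inferInstanceAs
    (Module K ((X.t ⟶ Y.t) × M.obj ⟨Y.u, op X.t⟩ × (X.u ⟶ Y.u)))
  smul_comp X Y Z a p q := by
    refine Prod.ext (Linear.smul_comp _ _ _ _ _ _) (Prod.ext ?_ (Linear.smul_comp _ _ _ _ _ _))
    change actT (a • p.1) q.2.1 + actU q.2.2 (a • p.2.1) =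
      a • (actT p.1 q.2.1 + actU q.2.2 p.2.1)
    rw [actT_smul, map_smul, smul_add]
  comp_smul X Y Z p a q := by
    refine Prod.ext (Linear.comp_smul _ _ _ _ _ _) (Prod.ext ?_ (Linear.comp_smul _ _ _ _ _ _))
    change actT p.1 (a • q.2.1) + actU (a • q.2.2) p.2.1 =
      a • (actT p.1 q.2.1 + actU q.2.2 p.2.1)
    rw [actU_smul, map_smul, smul_add]

theorem mkHom_zero [M.Additive] {X Y : TriCat M} : (mkHom 0 0 0 : X ⟶ Y) = 0 := rfl

theorem mkHom_add [M.Additive] {X Y : TriCat M} (f f' : X.t ⟶ Y.t)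
    (m m' : M.obj ⟨Y.u, op X.t⟩) (g g' : X.u ⟶ Y.u) :
    (mkHom f m g : X ⟶ Y) + mkHom f' m' g' = mkHom (f + f') (m + m') (g + g') := rfl

theorem mkHom_sum [M.Additive] {X Y : TriCat M} {ι : Type} (s : Finset ι) (f : ι → (X.t ⟶ Y.t))
    (g : ι → (X.u ⟶ Y.u)) :
    ∑ i ∈ s, (mkHom (f i) 0 (g i) : X ⟶ Y) = mkHom (∑ i ∈ s, f i) 0 (∑ i ∈ s, g i) := by
  classical
  induction s using Finset.induction_on with
  | empty => rfl
  | insert i s hi ih => rw [Finset.sum_insert hi, Finset.sum_insert hi, Finset.sum_insert hi, ih,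
      mkHom_add, add_zero]

/-- The triangular matrix category is additive: direct sums are formed componentwise. -/
instance hasFiniteBiproducts [HasFiniteBiproducts 𝒯] [HasFiniteBiproducts 𝒰] [M.Additive] :
    HasFiniteBiproducts (TriCat M) where
  out n :=
    { has_biproduct := fun F => by
        let b : Bicone F :=
          { pt := ⟨⨁ fun i => (F i).t, ⨁ fun i => (F i).u⟩
            π := fun i => mkHom (biproduct.π (fun i => (F i).t) i) 0
              (biproduct.π (fun i => (F i).u) i)
            ι := fun i => mkHom (biproduct.ι (fun i => (F i).t) i) 0
              (biproduct.ι (fun i => (F i).u) i)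
            ι_π := fun i j => by
              rw [mkHom_comp, map_zero, map_zero, add_zero]
              by_cases h : i = j
              · subst h
                simp [id_eq]
              · rw [dif_neg h, biproduct.ι_π_ne _ h, biproduct.ι_π_ne _ h, mkHom_zero] }
        refine hasBiproduct_of_total b ?_
        simp only [b, mkHom_comp, map_zero, add_zero]
        rw [mkHom_sum, biproduct.total, biproduct.total]
        rfl }

variable (M)

/-- The filtration `Λ_0 = [[0, 0], [M, 0]]`, `Λ_j = [[0, 0], [M, 𝒰_j]]` for `1 ≤ j ≤ n`,
`Λ_{n+j} = [[𝒯_j, 0], [M, 𝒰]]` for `j ≥ 1`. -/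
def filtration (n : ℕ) (BT : ℕ → ObjectProperty 𝒯) (BU : ℕ → ObjectProperty 𝒰) (j : ℕ) :
    ObjectProperty (TriCat M) := fun X =>
  if j = 0 then IsZero X.t ∧ IsZero X.u
  else if j ≤ n then IsZero X.t ∧ BU j X.u
  else BT (j - n) X.t

end TriCat

end Triangular

end QHCat

end

/-!
A heredity ideal is described by split generators. For `A` contained in `B`, the ideal `I_B / I_A`
of `C / I_A` is heredity if and only if a radical morphism of `C / I_A` between objects of `B` is
zero and, for every `X`, the module `I_B(X,-) / I_A(X,-)` is generated by one element `x` fixed by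
some `d` that annihilates the relations of `x` modulo `I_A`. Both conditions can be checked on
morphisms of `C` itself.

In `Λ` write `Λ(A, B)` for the matrices with `T ∈ A` and `U ∈ B`. If every `M_T` with `T ∈ A` is
generated by its values on `B`, then `I_{Λ(A, B)}` is the ideal of the matrices with diagonal
entries in `I_A` and `I_B` and with lower left entry in the trace of `B`. A factor of the filtration
of `Λ` is therefore governed by the corresponding factors for `𝒯`, `𝒰` and the modules `M_T`, and
split generators of these three assemble into a split generator for `Λ`. A `Δ`-filtered module
supplies them because its factors `𝒰(E,-) / I(E,-)` are generated by the class of `1_E`.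
The filtration of the theorem is `j ↦ Λ(𝒯_{j-n}, 𝒰_j)` with truncated subtraction: at each step
either `M_T = 0` or the whole of `𝒰` is available.
-/

noncomputable section

namespace QHCat

/-! ### Modules generated by one element -/

section Modules

variable {C : Type u} [Category.{v} C] {F G : C ⥤ AddCommGrpCat.{v}}

/-- The image of a morphism of modules, as a submodule of its target. -/
def Sub.range (φ : F ⟶ G) : Sub G where
  carrier X := (φ.app X).hom.range
  map_mem {X Y} f x := by
    rintro ⟨y, rfl⟩
    exact ⟨F.map f y, ConcreteCategory.congr_hom (φ.naturality f) y⟩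

/-- The projection of a module onto its quotient by a submodule. -/
def Sub.toQuotient (G : Sub F) : F ⟶ G.quotient where
  app X := AddCommGrpCat.ofHom (QuotientAddGroup.mk' (G.carrier X))

theorem Sub.toQuotient_eq_zero_iff (G : Sub F) {X : C} (x : F.obj X) :
    G.toQuotient.app X x = 0 ↔ x ∈ G.carrier X :=
  QuotientAddGroup.eq_zero_iff x

theorem Sub.toQuotient_surjective (G : Sub F) (X : C) :
    Function.Surjective (G.toQuotient.app X) :=
  QuotientAddGroup.mk'_surjective _

/-- The element `x` of the module `F` generates `F`, i.e. induces an epimorphism onto `F` from a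
representable module. -/
def Generates (F : C ⥤ AddCommGrpCat.{v}) {E : C} (x : F.obj E) : Prop :=
  ∀ ⦃Y : C⦄ (y : F.obj Y), ∃ s : E ⟶ Y, F.map s x = y

theorem Generates.hom_ext {E : C} {x : F.obj E} (hx : Generates F x) {φ ψ : F ⟶ G}
    (h : φ.app E x = ψ.app E x) : φ = ψ := by
  ext Y y
  obtain ⟨s, rfl⟩ := hx y
  rw [NatTrans.naturality_apply, NatTrans.naturality_apply, h]

variable [Preadditive C]

instance Sub.quotient_additive [F.Additive] (G : Sub F) : G.quotient.Additive where
  map_add {_ Y f g} := AddCommGrpCat.hom_ext <| QuotientAddGroup.addMonoidHom_ext _ <|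
    AddMonoidHom.ext fun x => congrArg (QuotientAddGroup.mk' (G.carrier Y))
      (ConcreteCategory.congr_hom (F.map_add (f := f) (g := g)) x)

theorem map_add_apply [F.Additive] {X Y : C} (f g : X ⟶ Y) (x : F.obj X) :
    F.map (f + g) x = F.map f x + F.map g x :=
  ConcreteCategory.congr_hom (F.map_add (f := f) (g := g)) x

theorem map_sub_apply [F.Additive] {X Y : C} (f g : X ⟶ Y) (x : F.obj X) :
    F.map (f - g) x = F.map f x - F.map g x :=
  ConcreteCategory.congr_hom (F.map_sub (f := f) (g := g)) x

theorem surjective_of_epi {F G : C ⥤+ AddCommGrpCat.{v}} (φ : F ⟶ G) [Epi φ] (X : C) :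
    Function.Surjective (φ.hom.app X) := by
  intro y
  let Q : C ⥤+ AddCommGrpCat.{v} := AdditiveFunctor.of (Sub.range φ.hom).quotient
  let p : G ⟶ Q := ⟨(Sub.range φ.hom).toQuotient⟩
  let z : G ⟶ Q := ⟨0⟩
  have hpz : p = z := by
    rw [← cancel_epi φ]
    ext Y x
    exact (Sub.toQuotient_eq_zero_iff _ _).2 ⟨x, rfl⟩
  have hy : p.hom.app X y = z.hom.app X y := by rw [hpz]
  exact (Sub.toQuotient_eq_zero_iff _ _).1 hy

theorem epi_of_surjective {F G : C ⥤+ AddCommGrpCat.{v}} (φ : F ⟶ G)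
    (h : ∀ X, Function.Surjective (φ.hom.app X)) : Epi φ where
  left_cancellation a b hab := by
    ext X y
    obtain ⟨x, rfl⟩ := h X y
    have hx : (φ ≫ a).hom.app X x = (φ ≫ b).hom.app X x := by rw [hab]
    exact hx

/-- The morphism `C(E,-) ⟶ F` that sends the identity of `E` to `m`, given by the Yoneda lemma. -/
def ofElement (F : C ⥤ AddCommGrpCat.{v}) [F.Additive] {E : C} (m : F.obj E) :
    preadditiveCoyoneda.obj (op E) ⟶ F where
  app Y := AddCommGrpCat.ofHom
    (AddMonoidHom.mk' (fun s : E ⟶ Y => F.map s m) fun s t => map_add_apply s t m)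
  naturality Y Z g := by
    ext s
    exact ConcreteCategory.congr_hom (F.map_comp s g) m

theorem ofElement_app_apply [F.Additive] {E Y : C} (m : F.obj E) (s : E ⟶ Y) :
    (ofElement F m).app Y s = F.map s m := rfl

theorem Generates.exists_hom [F.Additive] [G.Additive] {E : C} {x : F.obj E}
    (hx : Generates F x) (n : G.obj E)
    (hn : ∀ ⦃Y : C⦄ (s : E ⟶ Y), F.map s x = 0 → G.map s n = 0) :
    ∃ φ : F ⟶ G, φ.app E x = n := by
  choose s hs using hx
  have well_defined {Y : C} {a b : E ⟶ Y} (h : F.map a x = F.map b x) :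
      G.map a n = G.map b n := by
    rw [← sub_eq_zero, ← map_sub_apply] at h ⊢
    exact hn _ h
  let l (Y : C) : F.obj Y →+ G.obj Y := AddMonoidHom.mk' (fun y => G.map (s y) n) fun a b => by
    rw [← map_add_apply]
    exact well_defined (by rw [map_add_apply, hs, hs, hs])
  refine ⟨⟨fun Y => AddCommGrpCat.ofHom (l Y), fun Y Z g => ?_⟩, ?_⟩
  · ext y
    change G.map (s (F.map g y)) n = G.map g (G.map (s y) n)
    rw [← ConcreteCategory.comp_apply, ← G.map_comp]
    exact well_defined (by rw [hs, F.map_comp, ConcreteCategory.comp_apply, hs])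
  · change G.map (s x) n = n
    rw [well_defined (b := 𝟙 E) (by rw [hs, F.map_id]; rfl), G.map_id]
    rfl

theorem generates_id (E : C) : Generates (preadditiveCoyoneda.obj (op E)) (𝟙 E) :=
  fun _ s => ⟨s, Category.id_comp s⟩

instance projective_coyoneda (E : C) :
    Projective (AdditiveFunctor.of (preadditiveCoyoneda.obj (op E))) where
  factors {N Q} f p _ := by
    obtain ⟨n, hn⟩ := surjective_of_epi p E (f.hom.app E (𝟙 E))
    refine ⟨⟨ofElement N.obj n⟩, ?_⟩
    ext1
    refine (generates_id E).hom_ext (Eq.trans ?_ hn)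
    exact congrArg (p.hom.app E) (ConcreteCategory.congr_hom (N.obj.map_id E) n)

theorem Generates.projective_iff [F.Additive] {E : C} {x : F.obj E} (hx : Generates F x) :
    Projective (AdditiveFunctor.of F) ↔
      ∃ e : E ⟶ E, F.map e x = x ∧ ∀ ⦃Y : C⦄ (s : E ⟶ Y), F.map s x = 0 → e ≫ s = 0 := by
  let R : C ⥤+ AddCommGrpCat.{v} := AdditiveFunctor.of (preadditiveCoyoneda.obj (op E))
  let p : R ⟶ AdditiveFunctor.of F := ⟨ofElement F x⟩
  constructor
  · intro
    have : Epi p := epi_of_surjective p fun Y y => hx y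
    let i := Projective.factorThru (𝟙 (AdditiveFunctor.of F)) p
    have hip : i ≫ p = 𝟙 _ := Projective.factorThru_comp _ _
    refine ⟨i.hom.app E x, ?_, fun Y s hs => ?_⟩
    · exact ConcreteCategory.congr_hom (congrArg (fun φ => φ.hom.app E) hip) x
    · refine (NatTrans.naturality_apply i.hom s x).symm.trans ?_
      exact (congrArg (i.hom.app Y) hs).trans (map_zero _)
  · rintro ⟨e, he, hker⟩
    obtain ⟨i, hi⟩ := hx.exists_hom (G := preadditiveCoyoneda.obj (op E)) e hker
    have hip : i ≫ ofElement F x = 𝟙 F := hx.hom_ext <| by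
      rw [NatTrans.comp_app, ConcreteCategory.comp_apply, hi, ofElement_app_apply, he]
      rfl
    have hip' : (⟨i⟩ : AdditiveFunctor.of F ⟶ R) ≫ p = 𝟙 _ := by
      ext1
      exact hip
    exact Retract.projective ⟨_, p, hip'⟩

theorem isFinGen_iff [HasFiniteBiproducts C] [F.Additive] :
    IsFinGen F ↔ ∃ (E : C) (x : F.obj E), Generates F x := by
  constructor
  · rintro ⟨n, E, x, hx⟩
    refine ⟨⨁ E, ∑ i, F.map (biproduct.ι E i) (x i), fun Y y => ?_⟩
    obtain ⟨s, rfl⟩ := hx Y y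
    refine ⟨biproduct.desc s, ?_⟩
    simp only [map_sum, ← ConcreteCategory.comp_apply, ← F.map_comp, biproduct.ι_desc]
  · rintro ⟨E, x, hx⟩
    refine ⟨1, fun _ => E, fun _ => x, fun Y y => ?_⟩
    obtain ⟨s, rfl⟩ := hx y
    exact ⟨fun _ => s, (Fin.sum_univ_one fun _ : Fin 1 => F.map s x).symm⟩

end Modules

/-! ### The radical -/

section Radical

variable {C : Type u} [Category.{v} C] [Preadditive C]

theorem isIso_id_sub_comp_comm {X Y : C} (f : X ⟶ Y) (g : Y ⟶ X) [IsIso (𝟙 X - f ≫ g)] :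
    IsIso (𝟙 Y - g ≫ f) := by
  let k := inv (𝟙 X - f ≫ g)
  -- The geometric series suggests `(1 - g ≫ f)⁻¹ = 1 + g ≫ (1 - f ≫ g)⁻¹ ≫ f`.
  have h₁ : (𝟙 Y - g ≫ f) ≫ (𝟙 Y + g ≫ k ≫ f) =
      𝟙 Y + g ≫ ((𝟙 X - f ≫ g) ≫ k - 𝟙 X) ≫ f := by
    simp only [Preadditive.sub_comp, Preadditive.comp_sub, Preadditive.comp_add,
      Category.assoc, Category.id_comp, Category.comp_id]
    abel
  have h₂ : (𝟙 Y + g ≫ k ≫ f) ≫ (𝟙 Y - g ≫ f) =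
      𝟙 Y + g ≫ (k ≫ (𝟙 X - f ≫ g) - 𝟙 X) ≫ f := by
    simp only [Preadditive.sub_comp, Preadditive.comp_sub, Preadditive.add_comp,
      Category.assoc, Category.id_comp, Category.comp_id]
    abel
  exact ⟨_, h₁.trans (by rw [IsIso.hom_inv_id]; simp),
    h₂.trans (by rw [IsIso.inv_hom_id]; simp)⟩

theorem IsRadical.comp_right {X Y Z : C} {h : X ⟶ Y} (hh : IsRadical h) (g : Y ⟶ Z) :
    IsRadical (h ≫ g) := fun k => by
  rw [Category.assoc]
  exact hh (g ≫ k)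

theorem IsRadical.comp_left {W X Y : C} {h : X ⟶ Y} (hh : IsRadical h) (f : W ⟶ X) :
    IsRadical (f ≫ h) := fun k => by
  have := hh (k ≫ f)
  rw [← Category.assoc] at this
  rw [Category.assoc]
  exact isIso_id_sub_comp_comm (h ≫ k) f

theorem IsRadical.map {D : Type u₁} [Category.{v} D] [Preadditive D] (F : C ⥤ D) [F.Full]
    [F.Additive] {X Y : C} {h : X ⟶ Y} (hh : IsRadical h) : IsRadical (F.map h) := fun g => by
  obtain ⟨g, rfl⟩ := F.map_surjective g
  have := hh g
  rw [← F.map_id, ← F.map_comp, ← F.map_sub]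
  infer_instance

end Radical

/-! ### Heredity ideals of quotient categories -/

section Heredity

variable {C : Type u} [Category.{v} C] [Preadditive C]

namespace TwoSidedIdeal

variable (I J : TwoSidedIdeal C)

theorem proj_map_eq_iff {X Y : C} (f g : X ⟶ Y) :
    I.proj.map f = I.proj.map g ↔ f - g ∈ I.hom X Y :=
  CategoryTheory.Quotient.functor_map_eq_iff _ _ _

theorem proj_map_eq_zero_iff {X Y : C} (f : X ⟶ Y) : I.proj.map f = 0 ↔ f ∈ I.hom X Y := by
  rw [← I.proj.map_zero, proj_map_eq_iff, sub_zero]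

instance hasFiniteBiproducts_quot [HasFiniteBiproducts C] : HasFiniteBiproducts I.Quot where
  out n := ⟨fun F => inferInstanceAs (HasBiproduct (I.proj.obj ∘ fun i : Fin n => (F i).as))⟩

variable {I J} in
theorem proj_map_mem_modIdeal {X Y : C} {f : X ⟶ Y} (hf : f ∈ J.hom X Y) :
    I.proj.map f ∈ (J.modIdeal I).hom (I.proj.obj X) (I.proj.obj Y) := ⟨f, hf, rfl⟩

theorem isRadical_proj_map {D : Type u₁} [Category.{v} D] [Preadditive D]
    (I' : TwoSidedIdeal D) (F : C ⥤ D) [F.Full] [F.Additive]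
    (hF : ∀ ⦃X Y : C⦄ (f : X ⟶ Y), f ∈ I.hom X Y → F.map f ∈ I'.hom (F.obj X) (F.obj Y))
    {X Y : C} {h : X ⟶ Y} (hh : IsRadical (I.proj.map h)) : IsRadical (I'.proj.map (F.map h)) := by
  let G : I.Quot ⥤ I'.Quot := CategoryTheory.Quotient.lift I.rel (F ⋙ I'.proj)
    fun X Y f g hfg => by
      rw [Functor.comp_map, Functor.comp_map, proj_map_eq_iff, ← F.map_sub]
      exact hF _ hfg
  have : G.Full := ⟨fun {X Y} g => by
    obtain ⟨g, rfl⟩ := (F ⋙ I'.proj).map_surjective (X := X.as) (Y := Y.as) g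
    exact ⟨I.proj.map g, rfl⟩⟩
  have : G.Additive := ⟨fun {X Y f g} => by
    obtain ⟨f, rfl⟩ := I.proj.map_surjective (X := X.as) (Y := Y.as) f
    obtain ⟨g, rfl⟩ := I.proj.map_surjective (X := X.as) (Y := Y.as) g
    exact (F ⋙ I'.proj).map_add⟩
  exact hh.map G

end TwoSidedIdeal

/-- For submodules `G` and `H` of a `C`-module `F`, the `C / I`-module `(H + G) / G` is generated
by the class of `x`, and `e` is an endomorphism of `E` whose class in `C / I` splits the resulting
epimorphism from the module represented by `E`: in other words, `(H + G) / G` is a finitely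
generated projective `C / I`-module. Everything is expressed by representatives in `C` and `F`. -/
structure IsSplitGenerator (I : TwoSidedIdeal C) {F : C ⥤ AddCommGrpCat.{v}} (G H : Sub F) {E : C}
    (x : F.obj E) (e : E ⟶ E) : Prop where
  mem : x ∈ H.carrier E
  map_sub_mem : F.map e x - x ∈ G.carrier E
  exists_sub_mem : ∀ ⦃Y : C⦄, ∀ y ∈ H.carrier Y, ∃ s : E ⟶ Y, y - F.map s x ∈ G.carrier Y
  comp_mem : ∀ ⦃Y : C⦄ (s : E ⟶ Y), F.map s x ∈ G.carrier Y → e ≫ s ∈ I.hom E Y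

namespace TwoSidedIdeal

variable {I J : TwoSidedIdeal C}

theorem isSplitGenerator_row_iff {X E : C} {x : X ⟶ E} {e : E ⟶ E} :
    IsSplitGenerator I (I.row X) (J.row X) x e ↔
      x ∈ J.hom X E ∧ x ≫ e - x ∈ I.hom X E ∧
      (∀ ⦃Y : C⦄, ∀ y ∈ J.hom X Y, ∃ s : E ⟶ Y, y - x ≫ s ∈ I.hom X Y) ∧
      ∀ ⦃Y : C⦄ (s : E ⟶ Y), x ≫ s ∈ I.hom X Y → e ≫ s ∈ I.hom E Y :=
  ⟨fun h => ⟨h.mem, h.map_sub_mem, h.exists_sub_mem, h.comp_mem⟩,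
    fun ⟨hx, he, hgen, hker⟩ => ⟨hx, he, hgen, hker⟩⟩

theorem generates_proj_map_iff {X E : C} {x : X ⟶ E} (hx : x ∈ J.hom X E) :
    Generates ((J.modIdeal I).row (I.proj.obj X)).toFunctor (E := I.proj.obj E)
        ⟨I.proj.map x, proj_map_mem_modIdeal hx⟩ ↔
      ∀ ⦃Y : C⦄, ∀ y ∈ J.hom X Y, ∃ s : E ⟶ Y, y - x ≫ s ∈ I.hom X Y := by
  constructor
  · intro h Y y hy
    obtain ⟨s, hs⟩ := h (Y := I.proj.obj Y) ⟨I.proj.map y, proj_map_mem_modIdeal hy⟩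
    obtain ⟨s, rfl⟩ := I.proj.map_surjective s
    refine ⟨s, ?_⟩
    rw [← proj_map_eq_iff, I.proj.map_comp]
    exact (congrArg Subtype.val hs).symm
  · rintro h Y ⟨_, y, hy, rfl⟩
    obtain ⟨s, hs⟩ := h y hy
    refine ⟨I.proj.map s, Subtype.ext ?_⟩
    rw [← proj_map_eq_iff, I.proj.map_comp] at hs
    exact hs.symm

theorem projective_row_iff {X E : C} {x : X ⟶ E} (hx : x ∈ J.hom X E)
    (hgen : ∀ ⦃Y : C⦄, ∀ y ∈ J.hom X Y, ∃ s : E ⟶ Y, y - x ≫ s ∈ I.hom X Y) :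
    Projective (AdditiveFunctor.of ((J.modIdeal I).row (I.proj.obj X)).toFunctor) ↔
      ∃ e : E ⟶ E, x ≫ e - x ∈ I.hom X E ∧
        ∀ ⦃Y : C⦄ (s : E ⟶ Y), x ≫ s ∈ I.hom X Y → e ≫ s ∈ I.hom E Y := by
  simp only [((generates_proj_map_iff hx).2 hgen).projective_iff, ← proj_map_eq_zero_iff,
    I.proj.map_comp, I.proj.map_sub, sub_eq_zero]
  constructor
  · rintro ⟨e, he, hker⟩
    obtain ⟨e, rfl⟩ := I.proj.map_surjective e
    exact ⟨e, congrArg Subtype.val he, fun Y s hs => hker (I.proj.map s) (Subtype.ext hs)⟩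
  · rintro ⟨e, he, hker⟩
    refine ⟨I.proj.map e, Subtype.ext he, fun Y s hs => ?_⟩
    obtain ⟨s, rfl⟩ := I.proj.map_surjective (Y := Y.as) s
    exact hker s (congrArg Subtype.val hs)

variable [HasFiniteBiproducts C]

theorem projective_and_isFinGen_row_iff (X : C) :
    (Projective (AdditiveFunctor.of ((J.modIdeal I).row (I.proj.obj X)).toFunctor) ∧
        IsFinGen ((J.modIdeal I).row (I.proj.obj X)).toFunctor) ↔
      ∃ (E : C) (x : X ⟶ E) (e : E ⟶ E), IsSplitGenerator I (I.row X) (J.row X) x e := by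
  rw [isFinGen_iff]
  constructor
  · rintro ⟨hproj, E, ⟨_, x, hx, rfl⟩, hgen⟩
    obtain ⟨e, he, hker⟩ :=
      (projective_row_iff hx ((generates_proj_map_iff hx).1 hgen)).1 hproj
    exact ⟨_, x, e, hx, he, (generates_proj_map_iff hx).1 hgen, hker⟩
  · rintro ⟨E, x, e, hx, he, hgen, hker⟩
    exact ⟨(projective_row_iff hx hgen).2 ⟨e, he, hker⟩, I.proj.obj E, _,
      (generates_proj_map_iff hx).2 hgen⟩

end TwoSidedIdeal

variable [HasFiniteBiproducts C] {B B' : ObjectProperty C} {hB : IsAdditiveSubcat B}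
  {hB' : IsAdditiveSubcat B'} {I : TwoSidedIdeal C}

theorem mem_factorIdeal_of_left {X Y : C} (h : B X) (f : X ⟶ Y) :
    f ∈ (factorIdeal B hB).hom X Y := ⟨X, h, 𝟙 X, f, Category.id_comp f⟩

theorem mem_factorIdeal_of_right {X Y : C} (h : B Y) (f : X ⟶ Y) :
    f ∈ (factorIdeal B hB).hom X Y := ⟨Y, h, f, 𝟙 Y, Category.comp_id f⟩

theorem factorIdeal_mono (h : B ≤ B') (X Y : C) :
    (factorIdeal B hB).hom X Y ≤ (factorIdeal B' hB').hom X Y := by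
  rintro _ ⟨Z, hZ, r, s, rfl⟩
  exact ⟨Z, h _ hZ, r, s, rfl⟩

theorem IsSplitGenerator.exists_of_factorIdeal {X E : C} {x : X ⟶ E} {e : E ⟶ E}
    (h : IsSplitGenerator I (I.row X) ((factorIdeal B hB).row X) x e) :
    ∃ (Z : C) (_ : B Z) (r : X ⟶ Z) (e' : Z ⟶ Z),
      IsSplitGenerator I (I.row X) ((factorIdeal B hB).row X) r e' := by
  obtain ⟨⟨Z, hZ, r, s, rfl⟩, he, hgen, hker⟩ := TwoSidedIdeal.isSplitGenerator_row_iff.1 h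
  have hr : r ∈ (factorIdeal B hB).hom X Z := mem_factorIdeal_of_right hZ r
  obtain ⟨s', hs'⟩ := hgen r hr
  refine ⟨Z, hZ, r, s ≫ e ≫ s', TwoSidedIdeal.isSplitGenerator_row_iff.2
    ⟨hr, ?_, fun Y y hy => ?_, fun Y t ht => ?_⟩⟩
  · simpa using sub_mem (I.comp_mem _ s' he) hs'
  · obtain ⟨t, ht⟩ := hgen y hy
    exact ⟨s ≫ t, by simpa using ht⟩
  · have hst : (r ≫ s) ≫ s' ≫ t ∈ I.hom X Y := by
      simpa using sub_mem ht (I.comp_mem _ t hs')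
    simpa using I.mem_comp s _ (hker _ hst)

theorem isHeredity_modIdeal_factorIdeal_iff :
    ((factorIdeal B hB).modIdeal I).IsHeredity ↔
      (∀ ⦃X Y : C⦄ (h : X ⟶ Y), B X → B Y → IsRadical (I.proj.map h) → h ∈ I.hom X Y) ∧
      ∀ X : C, ∃ (E : C) (x : X ⟶ E) (e : E ⟶ E),
        IsSplitGenerator I (I.row X) ((factorIdeal B hB).row X) x e := by
  simp only [← TwoSidedIdeal.projective_and_isFinGen_row_iff]
  constructor
  · refine fun H => ⟨fun X Y h hX hY hh => ?_, fun X => ⟨H.projective _, H.finGen _⟩⟩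
    have := H.rad _ _ _ (I.proj_map_mem_modIdeal (mem_factorIdeal_of_left hX (𝟙 X))) hh
      (TwoSidedIdeal.proj_map_mem_modIdeal (mem_factorIdeal_of_left hY (𝟙 Y)))
    rwa [← Functor.map_comp, ← Functor.map_comp, Category.id_comp, Category.comp_id,
      I.proj_map_eq_zero_iff] at this
  · rintro ⟨hrad, hrow⟩
    refine ⟨fun X Y => le_antisymm ?_ ((AddSubgroup.closure_le _).2 ?_), ?_,
      fun X => (hrow X.as).1, fun X => (hrow X.as).2⟩
    · rintro _ ⟨_, ⟨Z, hZ, r, s, rfl⟩, rfl⟩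
      exact AddSubgroup.subset_closure ⟨I.proj.obj Z, I.proj.map r, I.proj.map s,
        TwoSidedIdeal.proj_map_mem_modIdeal (mem_factorIdeal_of_right hZ r),
        TwoSidedIdeal.proj_map_mem_modIdeal (mem_factorIdeal_of_left hZ s),
        (I.proj.map_comp r s).symm⟩
    · rintro _ ⟨Z, f, g, hf, -, rfl⟩
      exact TwoSidedIdeal.comp_mem _ f g hf
    · rintro W X Y Z _ h _ ⟨_, ⟨P, hP, a, b, rfl⟩, rfl⟩ hh ⟨_, ⟨Q, hQ, c, d, rfl⟩, rfl⟩
      obtain ⟨h, rfl⟩ := I.proj.map_surjective (X := X.as) (Y := Y.as) h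
      have hbc : b ≫ h ≫ c ∈ I.hom P Q := hrad _ hP hQ <| by
        rw [I.proj.map_comp, I.proj.map_comp]
        exact (hh.comp_right _).comp_left _
      change I.proj.map (a ≫ b) ≫ I.proj.map h ≫ I.proj.map (c ≫ d) = 0
      rw [← I.proj.map_comp, ← I.proj.map_comp, I.proj_map_eq_zero_iff]
      simpa using I.comp_mem _ d (I.mem_comp a _ hbc)

theorem isHeredity_modIdeal_self :
    ((factorIdeal B hB).modIdeal (factorIdeal B hB)).IsHeredity :=
  isHeredity_modIdeal_factorIdeal_iff.2
    ⟨fun _ _ h hX _ _ => mem_factorIdeal_of_left hX h, fun X => ⟨X, 0, 0,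
      TwoSidedIdeal.isSplitGenerator_row_iff.2 ⟨zero_mem _, by simp [zero_mem],
        fun _ y hy => ⟨0, by simpa using hy⟩, fun _ _ _ => by simp [zero_mem]⟩⟩⟩

end Heredity

/-! ### Quasi-hereditary filtrations -/

section Filtration

variable {C : Type u} [Category.{v} C] [Preadditive C] [HasFiniteBiproducts C]
  {B : ℕ → ObjectProperty C}

theorem IsAdditivelyClosed.of_isZero {B : ObjectProperty C} (hB : IsAdditivelyClosed B) {X : C}
    (hX : IsZero X) : B X := by
  obtain ⟨Z, hZ, hZ'⟩ := hB.exists_zero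
  exact hB.of_iso Z X (hZ'.iso hX) hZ

theorem IsExhaustiveFiltration.monotone (hB : IsExhaustiveFiltration B) : Monotone B :=
  monotone_nat_of_le_succ hB.mono

theorem IsExhaustiveFiltration.isHeredityChain (hB : IsExhaustiveFiltration B)
    (hzero : ∀ X, B 0 X → IsZero X)
    (h : ∀ j, ((factorIdeal (B (j + 1)) (hB.additive (j + 1))).modIdeal
      (factorIdeal (B j) (hB.additive j))).IsHeredity) :
    TwoSidedIdeal.IsHeredityChain fun j => factorIdeal (B j) (hB.additive j) where
  zero X Y := by
    rw [eq_bot_iff]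
    rintro _ ⟨Z, hZ, r, s, rfl⟩
    rw [(hzero Z hZ).eq_zero_of_tgt r, zero_comp]
    exact zero_mem _
  mono j := factorIdeal_mono (hB.mono j)
  exhaustive X Y f := by
    obtain ⟨j, hj⟩ := hB.exhaustive X
    exact ⟨j, mem_factorIdeal_of_left hj f⟩
  heredity := h

variable {K : Type w} [Field K] [Linear K C]

theorem IsQuasiHereditary.isZero_of_zero (h : IsQuasiHereditary K B) {X : C} (hX : B 0 X) :
    IsZero X := by
  rw [IsZero.iff_id_eq_zero]
  have hid := mem_factorIdeal_of_left (hB := h.filtration.additive 0) hX (𝟙 X)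
  rwa [h.heredityChain.zero, AddSubgroup.mem_bot] at hid

theorem IsQuasiHereditary.zero_iff_isZero (h : IsQuasiHereditary K B)
    (hclosed : IsAdditivelyClosed (B 0)) {X : C} : B 0 X ↔ IsZero X :=
  ⟨h.isZero_of_zero, hclosed.of_isZero⟩

theorem IsQuasiHereditary.delay (h : IsQuasiHereditary K B) (n : ℕ) :
    IsQuasiHereditary K fun j => B (j - n) :=
  have hfil : IsExhaustiveFiltration fun j => B (j - n) :=
    { additive := fun j => h.filtration.additive (j - n)
      mono := fun j => h.filtration.monotone (by lia)
      exhaustive := fun X => by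
        obtain ⟨j, hj⟩ := h.filtration.exhaustive X
        exact ⟨j + n, by simpa using hj⟩ }
  { homFinite := h.homFinite
    krullSchmidt := h.krullSchmidt
    filtration := hfil
    heredityChain := hfil.isHeredityChain
      (fun X hX => h.isZero_of_zero (by simpa using hX)) fun j => by
        obtain hj | hj : j + 1 - n = j - n ∨ j + 1 - n = j - n + 1 := by lia
        · simp only [hj]
          exact isHeredity_modIdeal_self
        · simp only [hj]
          exact h.heredityChain.heredity (j - n) }

end Filtration

/-! ### Traces and `Δ`-filtered modules -/

section Trace

variable {C : Type u} [Category.{v} C] {F G : C ⥤ AddCommGrpCat.{v}}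

theorem biproduct_ext_apply {n : ℕ} {S : Fin n → (C ⥤ AddCommGrpCat.{v})} {Y : C}
    {y z : (⨁ S : C ⥤ AddCommGrpCat.{v}).obj Y}
    (h : ∀ i, (biproduct.π S i).app Y y = (biproduct.π S i).app Y z) : y = z := by
  have htotal (w : (⨁ S : C ⥤ AddCommGrpCat.{v}).obj Y) :
      ∑ i, (biproduct.ι S i).app Y ((biproduct.π S i).app Y w) = w := by
    let ev : (⨁ S ⟶ ⨁ S) →+ (⨁ S : C ⥤ AddCommGrpCat.{v}).obj Y :=
      AddMonoidHom.mk' (fun θ => θ.app Y w) fun _ _ => rfl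
    exact (map_sum ev _ _).symm.trans (congrArg ev biproduct.total)
  rw [← htotal y, ← htotal z]
  simp only [h]

variable [Preadditive C]

theorem map_mem_trace {B : ObjectProperty C} [F.Additive] {E Y : C} (hE : B E) (m : F.obj E)
    (s : E ⟶ Y) : F.map s m ∈ (trace B F).carrier Y :=
  AddSubgroup.mem_iSup_of_mem E (AddSubgroup.mem_iSup_of_mem hE
    (AddSubgroup.mem_iSup_of_mem (ofElement F m) ⟨s, rfl⟩))

theorem trace_mono {B B' : ObjectProperty C} (h : B ≤ B') (Y : C) :
    (trace B F).carrier Y ≤ (trace B' F).carrier Y :=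
  iSup_mono fun E => iSup_mono' fun hE => ⟨h E hE, le_rfl⟩

theorem mem_trace_iff [HasFiniteBiproducts C] {B : ObjectProperty C} (hB : IsAdditiveSubcat B)
    [F.Additive] {Y : C} (y : F.obj Y) :
    y ∈ (trace B F).carrier Y ↔ ∃ (E : C) (_ : B E) (m : F.obj E) (s : E ⟶ Y), F.map s m = y := by
  constructor
  · let H : AddSubgroup (F.obj Y) :=
      { carrier := {y | ∃ (E : C) (_ : B E) (m : F.obj E) (s : E ⟶ Y), F.map s m = y}
        zero_mem' := by
          obtain ⟨Z, hZ, -⟩ := hB.exists_zero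
          exact ⟨Z, hZ, 0, 0, map_zero _⟩
        add_mem' := by
          rintro _ _ ⟨E, hE, m, s, rfl⟩ ⟨E', hE', m', s', rfl⟩
          obtain ⟨W, hW, ⟨e⟩⟩ := hB.exists_biprod E E' hE hE'
          refine ⟨W, hW, F.map (biprod.inl ≫ e.inv) m + F.map (biprod.inr ≫ e.inv) m',
            e.hom ≫ biprod.desc s s', ?_⟩
          rw [map_add, ← ConcreteCategory.comp_apply, ← ConcreteCategory.comp_apply,
            ← F.map_comp, ← F.map_comp]
          simp
        neg_mem' := by
          rintro _ ⟨E, hE, m, s, rfl⟩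
          exact ⟨E, hE, -m, s, map_neg _ _⟩ }
    suffices h : (trace B F).carrier Y ≤ H from fun hy => h hy
    refine iSup_le fun E => iSup_le fun hE => iSup_le fun η => ?_
    rintro _ ⟨s, rfl⟩
    exact ⟨E, hE, η.app E (𝟙 E), s, (NatTrans.naturality_apply η s (𝟙 E)).symm.trans
      (congrArg (η.app Y) (Category.id_comp s))⟩
  · rintro ⟨E, hE, m, s, rfl⟩
    exact map_mem_trace hE m s

/-- The element `x` generates the module `F`, and every relation between the values of `F` at `x`
holds modulo `I`. If `I` annihilates `F`, this says that `F` is the free `C / I`-module on `x`. -/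
structure IsFreeGenerator (I : TwoSidedIdeal C) (F : C ⥤ AddCommGrpCat.{v}) {E : C}
    (x : F.obj E) : Prop where
  generates : Generates F x
  mem_of_map_eq_zero : ∀ ⦃Y : C⦄ (s : E ⟶ Y), F.map s x = 0 → s ∈ I.hom E Y

namespace IsFreeGenerator

variable {I : TwoSidedIdeal C}

theorem quotient_row (E : C) :
    IsFreeGenerator I (I.row E).quotient ((I.row E).toQuotient.app E (𝟙 E)) := by
  have hmap {Y : C} (s : E ⟶ Y) : (I.row E).quotient.map s ((I.row E).toQuotient.app E (𝟙 E)) =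
      (I.row E).toQuotient.app Y s := congrArg _ (Category.id_comp s)
  refine ⟨fun Y y => ?_, fun Y s hs => ?_⟩
  · obtain ⟨s, rfl⟩ := (I.row E).toQuotient_surjective Y y
    exact ⟨s, hmap s⟩
  · exact ((I.row E).toQuotient_eq_zero_iff s).1 ((hmap s).symm.trans hs)

theorem of_iso {E : C} {x : F.obj E} (hx : IsFreeGenerator I F x) (φ : F ≅ G) :
    IsFreeGenerator I G (φ.hom.app E x) := by
  refine ⟨fun Y y => ?_, fun Y s hs => hx.mem_of_map_eq_zero s ?_⟩
  · obtain ⟨s, hs⟩ := hx.generates (φ.inv.app Y y)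
    exact ⟨s, by rw [← NatTrans.naturality_apply, hs]; simp⟩
  · rw [← NatTrans.naturality_apply] at hs
    simpa using congrArg (φ.inv.app Y) hs

theorem biproduct [HasFiniteBiproducts C] {n : ℕ} {S : Fin n → (C ⥤ AddCommGrpCat.{v})}
    {E : Fin n → C} {x : ∀ i, (S i).obj (E i)} (hx : ∀ i, IsFreeGenerator I (S i) (x i)) :
    IsFreeGenerator I (⨁ S)
      (∑ i, (⨁ S).map (biproduct.ι E i) ((biproduct.ι S i).app (E i) (x i))) := by
  have hπ {Y : C} (k : Fin n) (s : ⨁ E ⟶ Y) : (biproduct.π S k).app Y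
      ((⨁ S).map s (∑ i, (⨁ S).map (biproduct.ι E i) ((biproduct.ι S i).app (E i) (x i)))) =
        (S k).map (biproduct.ι E k ≫ s) (x k) := by
    rw [NatTrans.naturality_apply, map_sum, Functor.map_comp, ConcreteCategory.comp_apply,
      Finset.sum_eq_single_of_mem k (Finset.mem_univ k), NatTrans.naturality_apply,
      ← ConcreteCategory.comp_apply _ ((biproduct.π S k).app (E k)), ← NatTrans.comp_app,
      biproduct.ι_π_self]
    · rfl
    · intro i _ hi
      rw [NatTrans.naturality_apply, ← ConcreteCategory.comp_apply _ ((biproduct.π S k).app (E i)),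
        ← NatTrans.comp_app, biproduct.ι_π_ne _ hi]
      exact map_zero _
  refine ⟨fun Y y => ?_, fun Y s hs => ?_⟩
  · choose s hs using fun i => (hx i).generates ((biproduct.π S i).app Y y)
    refine ⟨biproduct.desc s, biproduct_ext_apply fun k => ?_⟩
    rw [hπ, biproduct.ι_desc, hs]
  · have hι (k : Fin n) : biproduct.ι E k ≫ s ∈ I.hom (E k) Y :=
      (hx k).mem_of_map_eq_zero _ (by rw [← hπ, hs, map_zero])
    rw [← Category.id_comp s, ← biproduct.total, Preadditive.sum_comp]
    simp only [Category.assoc]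
    exact sum_mem fun k _ => I.mem_comp _ _ (hι k)

theorem isSplitGenerator [F.Additive] {G H : Sub F} {E : C} {m : F.obj E}
    (hm : m ∈ H.carrier E)
    (hfree : IsFreeGenerator I (G.restrict H).quotient ((G.restrict H).toQuotient.app E ⟨m, hm⟩)) :
    IsSplitGenerator I G H m (𝟙 E) := by
  refine ⟨hm, by simp [zero_mem], fun Y y hy => ?_, fun Y s hs => ?_⟩
  · obtain ⟨s, hs⟩ := hfree.generates ((G.restrict H).toQuotient.app Y ⟨y, hy⟩)
    exact ⟨s, ((G.restrict H).toQuotient_eq_zero_iff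
      (⟨y, hy⟩ - ⟨F.map s m, H.map_mem s m hm⟩ : H.carrier Y)).1
        ((map_sub ((G.restrict H).toQuotient.app Y).hom _ _).trans (sub_eq_zero.2 hs.symm))⟩
  · rw [Category.id_comp]
    exact hfree.mem_of_map_eq_zero s (((G.restrict H).toQuotient_eq_zero_iff
      (⟨F.map s m, H.map_mem s m hm⟩ : H.carrier Y)).2 hs)

end IsFreeGenerator

theorem IsDeltaFiltered.exists_isSplitGenerator [HasFiniteBiproducts C] {B : ℕ → ObjectProperty C}
    {hB : ∀ j, IsAdditiveSubcat (B j)} [F.Additive] (hF : IsDeltaFiltered B hB F) (j : ℕ) :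
    ∃ (E : C) (m : F.obj E), IsSplitGenerator (factorIdeal (B j) (hB j)) (trace (B j) F)
      (trace (B (j + 1)) F) m (𝟙 E) := by
  obtain ⟨n, E, -, ⟨φ⟩⟩ := hF j
  obtain ⟨x, hfree⟩ : ∃ x : ((trace (B j) F).restrict (trace (B (j + 1)) F)).quotient.obj (⨁ E),
      IsFreeGenerator (factorIdeal (B j) (hB j)) _ x :=
    ⟨_, (IsFreeGenerator.biproduct fun i => IsFreeGenerator.quotient_row (E i)).of_iso φ.symm⟩
  obtain ⟨⟨m, hm⟩, rfl⟩ := Sub.toQuotient_surjective _ _ x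
  exact ⟨_, m, hfree.isSplitGenerator hm⟩

end Trace

/-! ### Triangular matrix categories -/

namespace TriCat

section Diagonal

variable {K : Type w} [Field K]
  {𝒯 : Type u₁} [Category.{v} 𝒯] [Preadditive 𝒯] [Linear K 𝒯]
  {𝒰 : Type u₂} [Category.{v} 𝒰] [Preadditive 𝒰] [Linear K 𝒰]
  {M : TensorCat K 𝒰 𝒯ᵒᵖ ⥤ ModuleCat.{v} K}
  {BT BT' : ObjectProperty 𝒯} {BU BU' : ObjectProperty 𝒰}

theorem exists_eq_mkHom {X Y : TriCat M} (p : X ⟶ Y) : ∃ f m g, p = mkHom f m g :=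
  ⟨p.1, p.2.1, p.2.2, rfl⟩

variable (M) in
/-- The functor `[[T, 0], [M, U]] ↦ T`. -/
def fstFunctor : TriCat M ⥤ 𝒯 where
  obj X := X.t
  map p := p.1

variable (M) in
/-- The functor `[[T, 0], [M, U]] ↦ U`. -/
def sndFunctor : TriCat M ⥤ 𝒰 where
  obj X := X.u
  map p := p.2.2

instance fstFunctor_full : (fstFunctor M).Full where
  map_surjective f := ⟨mkHom f 0 0, rfl⟩

instance sndFunctor_full : (sndFunctor M).Full where
  map_surjective g := ⟨mkHom 0 0 g, rfl⟩

/-- The isomorphism given by a diagonal matrix of isomorphisms. -/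
def isoMk {X Y : TriCat M} (e : X.t ≅ Y.t) (e' : X.u ≅ Y.u) : X ≅ Y where
  hom := mkHom e.hom 0 e'.hom
  inv := mkHom e.inv 0 e'.inv
  hom_inv_id := by simp [mkHom_comp, id_eq]
  inv_hom_id := by simp [mkHom_comp, id_eq]

variable (M) in
/-- The full subcategory of the matrices `[[T, 0], [M, U]]` with `T` in `BT` and `U` in `BU`. -/
def diag (BT : ObjectProperty 𝒯) (BU : ObjectProperty 𝒰) : ObjectProperty (TriCat M) :=
  fun X => BT X.t ∧ BU X.u

theorem filtration_eq_diag (n : ℕ) {BT : ℕ → ObjectProperty 𝒯} {BU : ℕ → ObjectProperty 𝒰}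
    (hT : ∀ T, BT 0 T ↔ IsZero T) (hU : ∀ U, BU 0 U ↔ IsZero U)
    (hUn : ∀ j, n ≤ j → ∀ U, BU j U) :
    filtration M n BT BU = fun j => diag M (BT (j - n)) (BU j) := by
  funext j X
  simp only [filtration, diag]
  split_ifs with h₀ h₁
  · rw [h₀, Nat.zero_sub, hT, hU]
  · rw [Nat.sub_eq_zero_of_le h₁, hT]
  · exact propext (iff_self_and.2 fun _ => hUn j (by lia) _)

variable (M) in
/-- The value at `U` of the trace of the modules `𝒰(E,-)`, `E` in `BU`, in `M_T`, as a subgroup of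
`M(U,T)`. -/
def columnTrace (BU : ObjectProperty 𝒰) (T : 𝒯) (U : 𝒰) : AddSubgroup (M.obj ⟨U, op T⟩) :=
  (trace BU (column M T)).carrier U

theorem actU_mem_columnTrace {T : 𝒯} {U U' : 𝒰} (g : U ⟶ U') {m : M.obj ⟨U, op T⟩}
    (hm : m ∈ columnTrace M BU T U) : actU g m ∈ columnTrace M BU T U' :=
  (trace BU (column M T)).map_mem g m hm

theorem isSplitGenerator_column_iff {I : TwoSidedIdeal 𝒰} {T : 𝒯} {E : 𝒰} {m : M.obj ⟨E, op T⟩}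
    {d : E ⟶ E} :
    IsSplitGenerator I (trace BU (column M T)) (trace BU' (column M T)) m d ↔
      m ∈ columnTrace M BU' T E ∧ actU d m - m ∈ columnTrace M BU T E ∧
      (∀ ⦃U : 𝒰⦄, ∀ y ∈ columnTrace M BU' T U, ∃ s : E ⟶ U,
        y - actU s m ∈ columnTrace M BU T U) ∧
      ∀ ⦃U : 𝒰⦄ (s : E ⟶ U), actU s m ∈ columnTrace M BU T U → d ≫ s ∈ I.hom E U :=
  ⟨fun h => ⟨h.mem, h.map_sub_mem, h.exists_sub_mem, h.comp_mem⟩,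
    fun ⟨hm, hd, hgen, hker⟩ => ⟨hm, hd, hgen, hker⟩⟩

variable (M) in
/-- The modules `M_T`, `T` in `BT`, are generated by their values on `BU`: they coincide with the
trace of the modules `𝒰(E,-)`, `E` in `BU`. -/
def GeneratesColumns (BU : ObjectProperty 𝒰) (BT : ObjectProperty 𝒯) : Prop :=
  ∀ ⦃T : 𝒯⦄, BT T → ∀ (U : 𝒰) (m : M.obj ⟨U, op T⟩), m ∈ columnTrace M BU T U

theorem GeneratesColumns.mono (h : GeneratesColumns M BU BT') (hT : BT ≤ BT') (hU : BU ≤ BU') :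
    GeneratesColumns M BU' BT :=
  fun _ hBT _ m => trace_mono hU _ (h (hT _ hBT) _ m)

variable [M.Additive]

instance fstFunctor_additive : (fstFunctor M).Additive where

instance sndFunctor_additive : (sndFunctor M).Additive where

instance column_additive (T : 𝒯) : (column M T).Additive where
  map_add {_ _ g g'} := by
    ext m
    exact actU_add (M := M) (T := T) g g' m

theorem mkHom_sub {X Y : TriCat M} (f f' : X.t ⟶ Y.t) (m m' : M.obj ⟨Y.u, op X.t⟩)
    (g g' : X.u ⟶ Y.u) :
    (mkHom f m g : X ⟶ Y) - mkHom f' m' g' = mkHom (f - f') (m - m') (g - g') := rfl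

theorem zero_actT {T T' : 𝒯} {U : 𝒰} (m : M.obj ⟨U, op T'⟩) : actT (0 : T ⟶ T') m = 0 := by
  have h := actT_add (0 : T ⟶ T') 0 m
  rwa [add_zero, left_eq_add] at h

theorem zero_actU {T : 𝒯} {U U' : 𝒰} (m : M.obj ⟨U, op T⟩) : actU (0 : U ⟶ U') m = 0 := by
  have h := actU_add (0 : U ⟶ U') 0 m
  rwa [add_zero, left_eq_add] at h

theorem eq_zero_of_isZero_t {T : 𝒯} {U : 𝒰} (hT : IsZero T) (m : M.obj ⟨U, op T⟩) : m = 0 := by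
  rw [← actT_id m, hT.eq_of_src (𝟙 T) 0, zero_actT]

theorem eq_zero_of_isZero_u {T : 𝒯} {U : 𝒰} (hU : IsZero U) (m : M.obj ⟨U, op T⟩) : m = 0 := by
  rw [← actU_id m, hU.eq_of_src (𝟙 U) 0, zero_actU]

theorem isZero_mk {T : 𝒯} {U : 𝒰} (hT : IsZero T) (hU : IsZero U) : IsZero (⟨T, U⟩ : TriCat M) := by
  rw [IsZero.iff_id_eq_zero] at hT hU ⊢
  rw [id_eq, hT, hU, mkHom_zero]

theorem mem_columnTrace_of_mem {T : 𝒯} {U : 𝒰} (hU : BU U) (m : M.obj ⟨U, op T⟩) :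
    m ∈ columnTrace M BU T U := by
  rw [← actU_id m]
  exact map_mem_trace (F := column M T) hU m (𝟙 U)

theorem mem_columnTrace_iff [HasFiniteBiproducts 𝒰] (hBU : IsAdditiveSubcat BU) {T : 𝒯} {U : 𝒰}
    {m : M.obj ⟨U, op T⟩} :
    m ∈ columnTrace M BU T U ↔
      ∃ (E : 𝒰) (_ : BU E) (m' : M.obj ⟨E, op T⟩) (s : E ⟶ U), actU s m' = m :=
  mem_trace_iff (F := column M T) hBU m

theorem generatesColumns_of_isZero (h : ∀ T, BT T → IsZero T) : GeneratesColumns M BU BT :=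
  fun T hT U m => by
    rw [eq_zero_of_isZero_t (h T hT) m]
    exact zero_mem _

theorem generatesColumns_of_forall (h : ∀ U, BU U) : GeneratesColumns M BU BT :=
  fun _ _ U m => mem_columnTrace_of_mem (h U) m

theorem generatesColumns_delay {n : ℕ} {BT : ℕ → ObjectProperty 𝒯} {BU : ℕ → ObjectProperty 𝒰}
    (hT : ∀ T, BT 0 T → IsZero T) (hU : ∀ j, n ≤ j → ∀ U, BU j U) (j : ℕ) :
    GeneratesColumns M (BU j) (BT (j + 1 - n)) := by
  obtain hj | hj := le_or_gt n j
  · exact generatesColumns_of_forall (hU j hj)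
  · rw [Nat.sub_eq_zero_of_le hj]
    exact generatesColumns_of_isZero hT

theorem actT_mem_columnTrace [HasFiniteBiproducts 𝒰] (hBU : IsAdditiveSubcat BU) {T T' : 𝒯}
    (f : T ⟶ T') {U : 𝒰} {m : M.obj ⟨U, op T'⟩} (hm : m ∈ columnTrace M BU T' U) :
    actT f m ∈ columnTrace M BU T U := by
  obtain ⟨E, hE, m, s, rfl⟩ := (mem_columnTrace_iff hBU).1 hm
  exact (mem_columnTrace_iff hBU).2 ⟨E, hE, actT f m, s, (actT_actU f s m).symm⟩

variable [HasFiniteBiproducts 𝒯] [HasFiniteBiproducts 𝒰]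

instance fstFunctor_preservesBinaryBiproducts : PreservesBinaryBiproducts (fstFunctor M) :=
  preservesBinaryBiproducts_of_preservesBiproducts _

instance sndFunctor_preservesBinaryBiproducts : PreservesBinaryBiproducts (sndFunctor M) :=
  preservesBinaryBiproducts_of_preservesBiproducts _

theorem isAdditiveSubcat_diag (hBT : IsAdditiveSubcat BT) (hBU : IsAdditiveSubcat BU) :
    IsAdditiveSubcat (diag M BT BU) where
  exists_zero := by
    obtain ⟨Z, hZ, hZ'⟩ := hBT.exists_zero
    obtain ⟨W, hW, hW'⟩ := hBU.exists_zero
    exact ⟨⟨Z, W⟩, ⟨hZ, hW⟩, isZero_mk hZ' hW'⟩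
  exists_biprod X Y hX hY := by
    obtain ⟨Z, hZ, ⟨e⟩⟩ := hBT.exists_biprod X.t Y.t hX.1 hY.1
    obtain ⟨W, hW, ⟨e'⟩⟩ := hBU.exists_biprod X.u Y.u hX.2 hY.2
    exact ⟨⟨Z, W⟩, ⟨hZ, hW⟩, ⟨isoMk (e ≪≫ ((fstFunctor M).mapBiprod X Y).symm)
      (e' ≪≫ ((sndFunctor M).mapBiprod X Y).symm)⟩⟩

theorem isAdditivelyClosed_diag (hBT : IsAdditivelyClosed BT) (hBU : IsAdditivelyClosed BU) :
    IsAdditivelyClosed (diag M BT BU) where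
  toIsAdditiveSubcat := isAdditiveSubcat_diag hBT.toIsAdditiveSubcat hBU.toIsAdditiveSubcat
  of_iso _ _ e h :=
    ⟨hBT.of_iso _ _ ((fstFunctor M).mapIso e) h.1, hBU.of_iso _ _ ((sndFunctor M).mapIso e) h.2⟩
  of_summand X Y h :=
    ⟨hBT.of_summand _ _ (hBT.of_iso _ _ ((fstFunctor M).mapBiprod X Y) h.1),
      hBU.of_summand _ _ (hBU.of_iso _ _ ((sndFunctor M).mapBiprod X Y) h.2)⟩

theorem isExhaustiveFiltration_diag {BT : ℕ → ObjectProperty 𝒯} {BU : ℕ → ObjectProperty 𝒰}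
    (hT : IsExhaustiveFiltration BT) (hU : IsExhaustiveFiltration BU) :
    IsExhaustiveFiltration fun j => diag M (BT j) (BU j) where
  additive j := isAdditiveSubcat_diag (hT.additive j) (hU.additive j)
  mono j _ h := ⟨hT.mono j _ h.1, hU.mono j _ h.2⟩
  exhaustive X := by
    obtain ⟨i, hi⟩ := hT.exhaustive X.t
    obtain ⟨j, hj⟩ := hU.exhaustive X.u
    exact ⟨max i j, hT.monotone (le_max_left i j) _ hi, hU.monotone (le_max_right i j) _ hj⟩

theorem mem_factorIdeal_diag_iff (hBT : IsAdditiveSubcat BT) (hBU : IsAdditiveSubcat BU)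
    {h : IsAdditiveSubcat (diag M BT BU)} (hgen : GeneratesColumns M BU BT) {X Y : TriCat M}
    {f : X.t ⟶ Y.t} {m : M.obj ⟨Y.u, op X.t⟩} {g : X.u ⟶ Y.u} :
    (mkHom f m g : X ⟶ Y) ∈ (factorIdeal (diag M BT BU) h).hom X Y ↔
      f ∈ (factorIdeal BT hBT).hom X.t Y.t ∧ m ∈ columnTrace M BU X.t Y.u ∧
        g ∈ (factorIdeal BU hBU).hom X.u Y.u := by
  constructor
  · rintro ⟨⟨T, U⟩, ⟨hT, hU⟩, ⟨f₁, m₁, g₁⟩, ⟨f₂, m₂, g₂⟩, ⟨⟩⟩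
    exact ⟨⟨T, hT, f₁, f₂, rfl⟩, add_mem (actT_mem_columnTrace hBU f₁ (hgen hT _ m₂))
      (actU_mem_columnTrace g₂ (mem_columnTrace_of_mem hU m₁)), ⟨U, hU, g₁, g₂, rfl⟩⟩
  · rintro ⟨⟨T, hT, f₁, f₂, rfl⟩, hm, ⟨U, hU, g₁, g₂, rfl⟩⟩
    obtain ⟨E, hE, m, s, rfl⟩ := (mem_columnTrace_iff hBU).1 hm
    obtain ⟨W, hW, ⟨i⟩⟩ := hBU.exists_biprod E U hE hU
    refine ⟨⟨T, W⟩, ⟨hT, hW⟩,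
      mkHom f₁ (actU (biprod.inl ≫ i.inv) m) (g₁ ≫ biprod.inr ≫ i.inv),
      mkHom f₂ 0 (i.hom ≫ biprod.desc s g₂), ?_⟩
    simp [mkHom_comp, ← actU_comp]

variable {hBT : IsAdditiveSubcat BT} {hBT' : IsAdditiveSubcat BT'} {hBU : IsAdditiveSubcat BU}
  {hBU' : IsAdditiveSubcat BU'} {h : IsAdditiveSubcat (diag M BT BU)}
  {h' : IsAdditiveSubcat (diag M BT' BU')}

theorem isSplitGenerator_diag (hT : BT ≤ BT') (hU : BU ≤ BU') (hgen : GeneratesColumns M BU BT')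
    {X : TriCat M} {T : 𝒯} (hT' : BT' T) {x : X.t ⟶ T} {e : T ⟶ T}
    (hx : IsSplitGenerator (factorIdeal BT hBT) ((factorIdeal BT hBT).row X.t)
      ((factorIdeal BT' hBT').row X.t) x e)
    {E : 𝒰} {m : M.obj ⟨E, op X.t⟩} {d : E ⟶ E}
    (hm : IsSplitGenerator (factorIdeal BU hBU) (trace BU (column M X.t))
      (trace BU' (column M X.t)) m d)
    {U : 𝒰} {x' : X.u ⟶ U} {e' : U ⟶ U}
    (hx' : IsSplitGenerator (factorIdeal BU hBU) ((factorIdeal BU hBU).row X.u)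
      ((factorIdeal BU' hBU').row X.u) x' e') :
    IsSplitGenerator (factorIdeal _ h) ((factorIdeal _ h).row X) ((factorIdeal _ h').row X)
      (mkHom x (actU biprod.inl m) (x' ≫ biprod.inr) : X ⟶ ⟨T, E ⊞ U⟩)
      (mkHom e 0 (biprod.map d e')) := by
  have mem_iff {Y Z : TriCat M} {f : Y.t ⟶ Z.t} {μ g} := mem_factorIdeal_diag_iff hBT hBU (h := h)
    (hgen.mono hT le_rfl) (X := Y) (Y := Z) (f := f) (m := μ) (g := g)
  have mem_iff' {Y Z : TriCat M} {f : Y.t ⟶ Z.t} {μ g} := mem_factorIdeal_diag_iff hBT' hBU'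
    (h := h') (hgen.mono le_rfl hU) (X := Y) (Y := Z) (f := f) (m := μ) (g := g)
  obtain ⟨hxJ, hxe, hxgen, hxker⟩ := TwoSidedIdeal.isSplitGenerator_row_iff.1 hx
  obtain ⟨hmJ, hmd, hmgen, hmker⟩ := isSplitGenerator_column_iff.1 hm
  obtain ⟨hxJ', hxe', hxgen', hxker'⟩ := TwoSidedIdeal.isSplitGenerator_row_iff.1 hx'
  refine TwoSidedIdeal.isSplitGenerator_row_iff.2 ⟨?_, ?_, fun Y y hy => ?_, fun Y s hs => ?_⟩
  · exact mem_iff'.2 ⟨hxJ, actU_mem_columnTrace _ hmJ, TwoSidedIdeal.comp_mem _ _ _ hxJ'⟩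
  · rw [mkHom_comp, mkHom_sub, mem_iff]
    refine ⟨hxe, ?_, ?_⟩
    · simpa [← actU_comp] using actU_mem_columnTrace biprod.inl hmd
    · simpa using TwoSidedIdeal.comp_mem _ _ biprod.inr hxe'
  · obtain ⟨a, b, c, rfl⟩ := exists_eq_mkHom y
    obtain ⟨ha, hb, hc⟩ := mem_iff'.1 hy
    obtain ⟨a', ha'⟩ := hxgen a ha
    obtain ⟨b', hb'⟩ := hmgen b hb
    obtain ⟨c', hc'⟩ := hxgen' c hc
    refine ⟨mkHom a' 0 (biprod.desc b' c'), ?_⟩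
    rw [mkHom_comp, mkHom_sub, mem_iff]
    exact ⟨ha', by simpa [← actU_comp] using hb', by simpa using hc'⟩
  · obtain ⟨f, μ, g, rfl⟩ := exists_eq_mkHom s
    have hμ : μ ∈ columnTrace M BU T Y.u := hgen hT' _ μ
    rw [mkHom_comp, mem_iff, ← actU_comp, add_mem_cancel_left (actT_mem_columnTrace hBU x hμ),
      Category.assoc] at hs
    rw [mkHom_comp, mem_iff, map_zero, add_zero]
    refine ⟨hxker f hs.1, actT_mem_columnTrace hBU e hμ, ?_⟩
    rw [biprod.map_eq, Preadditive.add_comp]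
    simpa using add_mem (TwoSidedIdeal.mem_comp _ biprod.fst _ (hmker _ hs.2.1))
      (TwoSidedIdeal.mem_comp _ biprod.snd _ (hxker' _ hs.2.2))

theorem isHeredity_diag (hT : BT ≤ BT') (hU : BU ≤ BU') (hgen : GeneratesColumns M BU BT')
    (hIT : ((factorIdeal BT' hBT').modIdeal (factorIdeal BT hBT)).IsHeredity)
    (hIU : ((factorIdeal BU' hBU').modIdeal (factorIdeal BU hBU)).IsHeredity)
    (hM : ∀ T : 𝒯, ∃ (E : 𝒰) (m : M.obj ⟨E, op T⟩) (d : E ⟶ E),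
      IsSplitGenerator (factorIdeal BU hBU) (trace BU (column M T)) (trace BU' (column M T)) m d) :
    ((factorIdeal (diag M BT' BU') h').modIdeal (factorIdeal (diag M BT BU) h)).IsHeredity := by
  rw [isHeredity_modIdeal_factorIdeal_iff] at hIT hIU ⊢
  refine ⟨fun X Y p hX hY hp => ?_, fun X => ?_⟩
  · obtain ⟨f, m, g, rfl⟩ := exists_eq_mkHom p
    refine (mem_factorIdeal_diag_iff hBT hBU (hgen.mono hT le_rfl)).2
      ⟨hIT.1 f hX.1 hY.1 ?_, hgen hX.1 _ m, hIU.1 g hX.2 hY.2 ?_⟩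
    · refine TwoSidedIdeal.isRadical_proj_map _ _ (fstFunctor M) ?_ hp
      rintro _ _ _ ⟨Z, hZ, r, s, rfl⟩
      exact ⟨Z.t, hZ.1, r.1, s.1, rfl⟩
    · refine TwoSidedIdeal.isRadical_proj_map _ _ (sndFunctor M) ?_ hp
      rintro _ _ _ ⟨Z, hZ, r, s, rfl⟩
      exact ⟨Z.u, hZ.2, r.2.2, s.2.2, rfl⟩
  · obtain ⟨_, _, _, hx⟩ := hIT.2 X.t
    obtain ⟨T, hT', x, e, hx⟩ := hx.exists_of_factorIdeal
    obtain ⟨E, m, d, hm⟩ := hM X.t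
    obtain ⟨U, x', e', hx'⟩ := hIU.2 X.u
    exact ⟨_, _, _, isSplitGenerator_diag hT hU hgen hT' hx hm hx'⟩

end Diagonal

end TriCat

/-! ### Krull–Schmidt decompositions -/

section KrullSchmidt

variable {C : Type u} [Category.{v} C] [Preadditive C] [HasFiniteBiproducts C]

theorem indecomposable_of_isLocalRing_end {X : C} (h : IsLocalRing (End X)) : Indecomposable X := by
  refine ⟨fun hX => zero_ne_one (α := End X) (hX.eq_of_src _ _), fun Y Z φ => ?_⟩
  let p : End X := φ.hom ≫ biprod.fst ≫ biprod.inl ≫ φ.inv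
  let q : End X := φ.hom ≫ biprod.snd ≫ biprod.inr ≫ φ.inv
  have hpq : p + q = 1 := by
    have : p + q = φ.hom ≫ (biprod.fst ≫ biprod.inl + biprod.snd ≫ biprod.inr) ≫ φ.inv := by
      simp only [p, q, Preadditive.add_comp, Preadditive.comp_add, Category.assoc]
    rw [this, biprod.total, Category.id_comp, φ.hom_inv_id, End.one_def]
  refine (IsLocalRing.isUnit_or_isUnit_of_add_one hpq).symm.imp (fun hq => ?_) fun hp => ?_
  · rw [IsZero.iff_id_eq_zero]
    have hq : IsIso q := (isUnit_iff_isIso q).1 hq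
    have : (biprod.inl ≫ φ.inv) ≫ q = 0 := by simp [q]
    have : biprod.inl ≫ φ.inv = 0 := zero_of_comp_mono q this
    simpa using this =≫ (φ.hom ≫ biprod.fst)
  · rw [IsZero.iff_id_eq_zero]
    have hp : IsIso p := (isUnit_iff_isIso p).1 hp
    have : (biprod.inr ≫ φ.inv) ≫ p = 0 := by simp [p]
    have : biprod.inr ≫ φ.inv = 0 := zero_of_comp_mono p this
    simpa using this =≫ (φ.hom ≫ biprod.snd)

/-- The decomposition of the direct sum of a family indexed by `Fin m ⊕ Fin n` into the direct sums
of its two halves. -/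
def biproductSumIso {m n : ℕ} (E : Fin m ⊕ Fin n → C) :
    ⨁ E ≅ (⨁ fun i => E (Sum.inl i)) ⊞ ⨁ fun i => E (Sum.inr i) where
  hom := biprod.lift (biproduct.lift fun i => biproduct.π E (Sum.inl i))
    (biproduct.lift fun i => biproduct.π E (Sum.inr i))
  inv := biprod.desc (biproduct.desc fun i => biproduct.ι E (Sum.inl i))
    (biproduct.desc fun i => biproduct.ι E (Sum.inr i))
  hom_inv_id := by
    rw [biprod.lift_desc, biproduct.lift_desc, biproduct.lift_desc, ← Fintype.sum_sum_type
      fun i => biproduct.π E i ≫ biproduct.ι E i, biproduct.total]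
  inv_hom_id := by ext <;> simp [biproduct.ι_π]

/-- `X` is a finite direct sum of objects with local endomorphism rings. -/
def HasLocalDecomposition (X : C) : Prop :=
  ∃ (n : ℕ) (E : Fin n → C), (∀ i, IsLocalRing (End (E i))) ∧ Nonempty (X ≅ ⨁ E)

theorem isKrullSchmidt_iff : IsKrullSchmidt C ↔ ∀ X : C, HasLocalDecomposition X :=
  forall_congr' fun _ => exists₂_congr fun _ _ => and_congr_left' <| forall_congr' fun _ =>
    and_iff_right_of_imp indecomposable_of_isLocalRing_end

namespace HasLocalDecomposition

variable {X Y : C}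

theorem of_iso (hX : HasLocalDecomposition X) (φ : X ≅ Y) : HasLocalDecomposition Y := by
  obtain ⟨n, E, hE, ⟨ψ⟩⟩ := hX
  exact ⟨n, E, hE, ⟨φ.symm ≪≫ ψ⟩⟩

theorem biprod (hX : HasLocalDecomposition X) (hY : HasLocalDecomposition Y) :
    HasLocalDecomposition (X ⊞ Y) := by
  obtain ⟨m, E, hE, ⟨φ⟩⟩ := hX
  obtain ⟨n, E', hE', ⟨ψ⟩⟩ := hY
  have hlocal : ∀ i, IsLocalRing (End (Sum.elim E E' i)) := Sum.forall.2 ⟨hE, hE'⟩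
  exact ⟨m + n, Sum.elim E E' ∘ finSumFinEquiv.symm, fun i => hlocal _,
    ⟨biprod.mapIso φ ψ ≪≫ (biproductSumIso (Sum.elim E E')).symm ≪≫
      (biproduct.reindex finSumFinEquiv.symm (Sum.elim E E')).symm⟩⟩

theorem map {D : Type u₁} [Category.{v} D] [Preadditive D] [HasFiniteBiproducts D]
    (hX : HasLocalDecomposition X) (F : C ⥤ D) [F.Full] [F.Faithful] [F.Additive] :
    HasLocalDecomposition (F.obj X) := by
  obtain ⟨n, E, hE, ⟨φ⟩⟩ := hX
  refine ⟨n, F.obj ∘ E, fun i => ?_, ⟨F.mapIso φ ≪≫ F.mapBiproduct E⟩⟩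
  let ψ : End (E i) ≃+* End (F.obj (E i)) :=
    { (Functor.FullyFaithful.ofFullyFaithful F).mulEquivEnd (E i) with
      map_add' := fun _ _ => F.map_add }
  have := hE i
  exact (ψ.symm : End (F.obj (E i)) →+* End (E i)).domain_isLocalRing

end HasLocalDecomposition

end KrullSchmidt

namespace TriCat

variable {K : Type w} [Field K]
  {𝒯 : Type u₁} [Category.{v} 𝒯] [Preadditive 𝒯] [Linear K 𝒯]
  {𝒰 : Type u₂} [Category.{v} 𝒰] [Preadditive 𝒰] [Linear K 𝒰]
  {M : TensorCat K 𝒰 𝒯ᵒᵖ ⥤ ModuleCat.{v} K} [M.Additive]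

section KrullSchmidt

variable [HasFiniteBiproducts 𝒯] [HasFiniteBiproducts 𝒰]

open scoped ZeroObject

attribute [local instance] hasZeroObject_of_hasFiniteBiproducts

variable (M) in
/-- The embedding `T ↦ [[T, 0], [M, 0]]`. -/
def inclFst : 𝒯 ⥤ TriCat M where
  obj T := ⟨T, 0⟩
  map f := mkHom f 0 0
  map_id T := Prod.ext rfl (Prod.ext rfl ((isZero_zero 𝒰).eq_of_src _ _))
  map_comp f f' := by simp [mkHom_comp]

variable (M) in
/-- The embedding `U ↦ [[0, 0], [M, U]]`. -/
def inclSnd : 𝒰 ⥤ TriCat M where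
  obj U := ⟨0, U⟩
  map g := mkHom 0 0 g
  map_id U := Prod.ext ((isZero_zero 𝒯).eq_of_src _ _) rfl
  map_comp g g' := by simp [mkHom_comp]

instance inclFst_additive : (inclFst M).Additive where
  map_add := Prod.ext rfl (Prod.ext (add_zero _).symm (add_zero _).symm)

instance inclSnd_additive : (inclSnd M).Additive where
  map_add := Prod.ext (add_zero _).symm (Prod.ext (add_zero _).symm rfl)

instance inclFst_faithful : (inclFst M).Faithful where
  map_injective h := congrArg Prod.fst h

instance inclSnd_faithful : (inclSnd M).Faithful where
  map_injective h := congrArg (fun p => p.2.2) h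

instance inclFst_full : (inclFst M).Full where
  map_surjective p := by
    obtain ⟨f, m, g, rfl⟩ := exists_eq_mkHom p
    rw [eq_zero_of_isZero_u (isZero_zero 𝒰) m, (isZero_zero 𝒰).eq_of_src g 0]
    exact ⟨f, rfl⟩

instance inclSnd_full : (inclSnd M).Full where
  map_surjective p := by
    obtain ⟨f, m, g, rfl⟩ := exists_eq_mkHom p
    rw [eq_zero_of_isZero_t (isZero_zero 𝒯) m, (isZero_zero 𝒯).eq_of_src f 0]
    exact ⟨g, rfl⟩

/-- The decomposition `[[T, 0], [M, U]] ≅ [[T, 0], [M, 0]] ⊕ [[0, 0], [M, U]]`. -/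
def isoBiprodIncl (X : TriCat M) : X ≅ (inclFst M).obj X.t ⊞ (inclSnd M).obj X.u :=
  isoMk (isoBiprodZero (isZero_zero 𝒯) ≪≫
      ((fstFunctor M).mapBiprod ((inclFst M).obj X.t) ((inclSnd M).obj X.u)).symm)
    (isoZeroBiprod (isZero_zero 𝒰) ≪≫
      ((sndFunctor M).mapBiprod ((inclFst M).obj X.t) ((inclSnd M).obj X.u)).symm)

theorem isKrullSchmidt (hT : IsKrullSchmidt 𝒯) (hU : IsKrullSchmidt 𝒰) :
    IsKrullSchmidt (TriCat M) := by
  rw [isKrullSchmidt_iff] at hT hU ⊢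
  exact fun X => (((hT X.t).map (inclFst M)).biprod ((hU X.u).map (inclSnd M))).of_iso
    (isoBiprodIncl X).symm

end KrullSchmidt

section HomFinite

variable [M.Linear K]

theorem isHomFinite (hT : IsHomFinite 𝒯 K) (hU : IsHomFinite 𝒰 K)
    (hM : ∀ (U : 𝒰) (T : 𝒯), FiniteDimensional K (M.obj ⟨U, op T⟩)) :
    IsHomFinite (TriCat M) K := fun X Y => by
  have := hT X.t Y.t
  have := hU X.u Y.u
  have := hM Y.u X.t
  exact inferInstanceAs (FiniteDimensional K ((X.t ⟶ Y.t) × M.obj ⟨Y.u, op X.t⟩ × (X.u ⟶ Y.u)))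

variable [HasFiniteBiproducts 𝒰]

theorem exists_finiteDimensional_columnTrace_le {BU : ℕ → ObjectProperty 𝒰}
    (hBU : ∀ j, IsAdditiveSubcat (BU j)) (hzero : ∀ U, BU 0 U → IsZero U) (hfin : IsHomFinite 𝒰 K)
    {T : 𝒯} (hM : IsDeltaFiltered BU hBU (column M T)) (U : 𝒰) (j : ℕ) :
    ∃ S : Submodule K (M.obj ⟨U, op T⟩), FiniteDimensional K S ∧
      columnTrace M (BU j) T U ≤ S.toAddSubgroup := by
  induction j with
  | zero =>
    refine ⟨⊥, inferInstance, fun m hm => ?_⟩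
    obtain ⟨E, hE, m, s, rfl⟩ := (mem_columnTrace_iff (hBU 0)).1 hm
    rw [eq_zero_of_isZero_u (hzero E hE) m, map_zero]
    exact zero_mem _
  | succ j ih =>
    obtain ⟨S, hS, hle⟩ := ih
    obtain ⟨E, m, hm⟩ := hM.exists_isSplitGenerator j
    obtain ⟨-, -, hgen, -⟩ := isSplitGenerator_column_iff.1 hm
    let action : (E ⟶ U) →ₗ[K] M.obj ⟨U, op T⟩ :=
      { toFun := fun s => actU s m
        map_add' := fun s s' => actU_add s s' m
        map_smul' := fun a s => actU_smul a s m }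
    have := hfin E U
    refine ⟨S ⊔ LinearMap.range action, inferInstance, fun y hy => ?_⟩
    obtain ⟨s, hs⟩ := hgen y hy
    exact Submodule.mem_sup.2 ⟨_, hle hs, action s, ⟨s, rfl⟩, sub_add_cancel y _⟩

theorem finiteDimensional_obj {BU : ℕ → ObjectProperty 𝒰} (hU : IsQuasiHereditary K BU) {T : 𝒯}
    (hM : IsDeltaFiltered BU hU.filtration.additive (column M T)) (U : 𝒰) :
    FiniteDimensional K (M.obj ⟨U, op T⟩) := by
  obtain ⟨j, hj⟩ := hU.filtration.exhaustive U
  obtain ⟨S, hS, hle⟩ := exists_finiteDimensional_columnTrace_le hU.filtration.additive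
    (fun _ => hU.isZero_of_zero) hU.homFinite hM U j
  have htop : S = ⊤ := Submodule.eq_top_iff'.2 fun m => hle (mem_columnTrace_of_mem hj m)
  exact Module.finite_def.2 (htop ▸ Module.Finite.iff_fg.1 hS)

end HomFinite

end TriCat

end QHCat

end

open QHCat QHCat.TriCat in
theorem mainTheorem1_general {K : Type w} [Field K]
    {𝒯 : Type u₁} [Category.{v} 𝒯] [Preadditive 𝒯] [Linear K 𝒯] [HasFiniteBiproducts 𝒯]
    {𝒰 : Type u₂} [Category.{v} 𝒰] [Preadditive 𝒰] [Linear K 𝒰] [HasFiniteBiproducts 𝒰]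
    {BU : ℕ → ObjectProperty 𝒰} {BT : ℕ → ObjectProperty 𝒯}
    (hU : IsQuasiHereditary K BU) (hT : IsQuasiHereditary K BT)
    {M : TensorCat K 𝒰 𝒯ᵒᵖ ⥤ ModuleCat.{v} K} [M.Additive] [M.Linear K]
    (hM : ∀ T : 𝒯, IsDeltaFiltered BU hU.filtration.additive (column M T))
    (hgen : ∀ j, GeneratesColumns M (BU j) (BT (j + 1))) :
    IsQuasiHereditary K fun j => diag M (BT j) (BU j) :=
  have hfil := isExhaustiveFiltration_diag (M := M) hT.filtration hU.filtration
  { homFinite := isHomFinite hT.homFinite hU.homFinite fun U T => finiteDimensional_obj hU (hM T) U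
    krullSchmidt := isKrullSchmidt hT.krullSchmidt hU.krullSchmidt
    filtration := hfil
    heredityChain := hfil.isHeredityChain
      (fun _ h => isZero_mk (hT.isZero_of_zero h.1) (hU.isZero_of_zero h.2)) fun j =>
        isHeredity_diag (hT.filtration.mono j) (hU.filtration.mono j) (hgen j)
          (hT.heredityChain.heredity j) (hU.heredityChain.heredity j) fun T => by
            obtain ⟨E, m, hm⟩ := (hM T).exists_isSplitGenerator j
            exact ⟨E, m, 𝟙 E, hm⟩ }

theorem mainTheorem1 {K : Type w} [Field K]
    {𝒯 : Type u₁} [Category.{v} 𝒯] [Preadditive 𝒯] [Linear K 𝒯] [HasFiniteBiproducts 𝒯]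
    {𝒰 : Type u₂} [Category.{v} 𝒰] [Preadditive 𝒰] [Linear K 𝒰] [HasFiniteBiproducts 𝒰]
    (n : ℕ) (BU : ℕ → ObjectProperty 𝒰) (BT : ℕ → ObjectProperty 𝒯)
    (hU : QHCat.IsQuasiHereditary K BU) (hUclosed : ∀ j, QHCat.IsAdditivelyClosed (BU j))
    (hUfinite : ∀ j, n ≤ j → ∀ U : 𝒰, BU j U)
    (hT : QHCat.IsQuasiHereditary K BT) (hTclosed : ∀ j, QHCat.IsAdditivelyClosed (BT j))
    (M : QHCat.TensorCat K 𝒰 𝒯ᵒᵖ ⥤ ModuleCat.{v} K) [M.Additive] [M.Linear K]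
    (hM : ∀ T : 𝒯, QHCat.IsDeltaFiltered BU hU.filtration.additive (QHCat.TriCat.column M T)) :
    QHCat.IsQuasiHereditary K (QHCat.TriCat.filtration M n BT BU) ∧
      ∀ j, QHCat.IsAdditivelyClosed (QHCat.TriCat.filtration M n BT BU j) := by
  rw [QHCat.TriCat.filtration_eq_diag n (fun _ => hT.zero_iff_isZero (hTclosed 0))
    (fun _ => hU.zero_iff_isZero (hUclosed 0)) hUfinite]
  exact ⟨mainTheorem1_general hU (hT.delay n) hM
      (QHCat.TriCat.generatesColumns_delay (fun _ => hT.isZero_of_zero) hUfinite),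
    fun j => QHCat.TriCat.isAdditivelyClosed_diag (hTclosed _) (hUclosed j)⟩
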